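/- Let $n$ be a positive integer, $A_n=\mathbb{C}[t_1,\dots,t_n]$, $\partial_i=\partial/\partial t_i$, $W_n=\mathrm{Der}(A_n)=\bigoplus_i A_n\partial_i$, $\Delta_n=\mathrm{span}\{\partial_1,\dots,\partial_n\}$, and let $L_n\subset W_n$ be the Lie subalgebra of vector fields vanishing at the origin, spanned by the $t^{\mathbf m}\partial_i$ with $|\mathbf m|\ge 1$. An $(A_n,W_n)$-module is a complex vector space $M$ that is a unital $A_n$-module and a $W_n$-module with $X(fv)-f(Xv)=X(f)\,v$ for $X\in W_n$, $f\in A_n$, $v\in M$; homomorphisms are the linear maps commuting with $A_n$ and $W_n$. Fix $\mathbf a=(a_1,\dots,a_n)\in\mathbb{C}^n$, let $\phi_{\mathbf a}:\Delta_n\to\mathbb{C}$ be the linear map with $\phi_{\mathbf a}(\partial_i)=a_i$, and put $\mathrm{Wh}_{\mathbf a}(M)=\{v\in M\mid \partial_i v=a_i v\text{ for all }i\}$. Let $\Omega_{\mathbf a}^{\widetilde W}$ be the category of those $(A_n,W_n)$-modules $M$ such that for every $v\in M$ there is a $k$ with $(x-\phi_{\mathbf a}(x))^k v=0$ for all $x\in\Delta_n$,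 and such that $\dim \mathrm{Wh}_{\mathbf a}(M)<\infty$. Let $L_n\text{-mod}$ be the category of finite-dimensional $L_n$-modules. For $V\in L_n\text{-mod}$ let $T(A_n^{\mathbf a},V)$ be the vector space $A_n\otimes V$ with $A_n$ acting by multiplication on the first factor and $$t^{\mathbf m}\partial_k(p\otimes v)=t^{\mathbf m}(\partial_k p+a_kp)\otimes v+\sum_{0\ne\mathbf r\le\mathbf m}\binom{\mathbf m}{\mathbf r}t^{\mathbf m-\mathbf r}p\otimes (t^{\mathbf r}\partial_k)v .$$ For $M\in\Omega_{\mathbf a}^{\widetilde W}$ let $L_n$ act on $\mathrm{Wh}_{\mathbf a}(M)$ by $$(t^{\mathbf m}\partial_k)\ast v=\sum_{\mathbf 0\le \mathbf r\le\mathbf m}(-1)^{|\mathbf r|}\binom{\mathbf m}{\mathbf r}t^{\mathbf r}\bigl((t^{\mathbf m-\mathbf r}\partial_k)v\bigr),\qquad |\mathbf m|\ge 1 .$$ **Theorem.** The functor $L_n\text{-mod}\to\Omega_{\mathbf a}^{\widetilde W}$, $V\mapsto T(A_n^{\mathbf a},V)$, $g\mapsto \mathrm{id}\otimes g$, is an equivalence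 of categories, and the functor $M\mapsto \mathrm{Wh}_{\mathbf a}(M)$, $f\mapsto f|_{\mathrm{Wh}_{\mathbf a}(M)}$, is a quasi-inverse of it. -/

import Mathlib

open MvPolynomial TensorProduct CategoryTheory

universe u

noncomputable section

namespace WhittakerWitt

/-! ### The polynomial algebra, the Witt algebra and the jet Lie algebra -/

/-- The polynomial algebra `A_n = ℂ[t_1, …, t_n]`. -/
abbrev Poly (n : ℕ) : Type := MvPolynomial (Fin n) ℂ

/-- The Witt algebra `W_n = Der(A_n)` of polynomial vector fields, with the commutator bracket. -/
abbrev Witt (n : ℕ) : Type := Derivation ℂ (Poly n) (Poly n)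

/-- The map `f ↦ f ∂_k`. -/
def field {n : ℕ} (k : Fin n) : Poly n →ₗ[ℂ] Witt n :=
  (LinearMap.toSpanSingleton (Poly n) (Witt n) (pderiv k)).restrictScalars ℂ

@[simp] lemma field_apply {n : ℕ} (k : Fin n) (f : Poly n) :
    field k f = f • (pderiv k : Witt n) := rfl

/-- The `k`-th coefficient `X ↦ X(t_k)` of a vector field `X = ∑ X(t_k) ∂_k`. -/
def comp {n : ℕ} (k : Fin n) : Witt n →ₗ[ℂ] Poly n where
  toFun D := D (X k)
  map_add' _ _ := rfl
  map_smul' _ _ := rfl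

@[simp] lemma comp_apply {n : ℕ} (k : Fin n) (D : Witt n) : comp k D = D (X k) := rfl

lemma witt_eq_sum {n : ℕ} (D : Witt n) : D = ∑ k, D (X k) • (pderiv k : Witt n) := by
  apply derivation_ext
  intro i
  have h : (∑ k, D (X k) • (pderiv k : Witt n)) (X i) = ∑ k, (D (X k) • (pderiv k : Witt n)) (X i) :=
    map_sum (comp i) _ _
  rw [h]
  simp [pderiv_X, Pi.single_apply]

lemma witt_apply {n : ℕ} (D : Witt n) (f : Poly n) : D f = ∑ k, D (X k) * pderiv k f := by
  conv_lhs => rw [witt_eq_sum D]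
  have h : (∑ k, D (X k) • (pderiv k : Witt n)) f = ∑ k, (D (X k) • (pderiv k : Witt n)) f :=
    map_sum (⟨⟨fun E : Witt n => E f, fun _ _ => rfl⟩, fun _ _ => rfl⟩ : Witt n →ₗ[ℂ] Poly n) _ _
  rw [h]
  simp

/-- The jet Lie algebra `L_n`: the polynomial vector fields `∑ f_i ∂_i` vanishing at the origin,
i.e. with `f_i(0) = 0` for all `i`. -/
def Jet (n : ℕ) : LieSubalgebra ℂ (Witt n) where
  carrier := {D | ∀ i, constantCoeff (D (X i)) = 0}
  add_mem' := by
    intro D E hD hE i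
    simp [hD i, hE i]
  zero_mem' := by intro i; simp
  smul_mem' := by
    intro c D hD i
    simp [hD i]
  lie_mem' := by
    intro D E hD hE i
    have h : ∀ (D : Witt n), (∀ i, constantCoeff (D (X i)) = 0) → ∀ f,
        constantCoeff (D f) = 0 := by
      intro D hD f
      rw [witt_apply, map_sum]
      exact Finset.sum_eq_zero fun k _ => by rw [map_mul, hD k, zero_mul]
    simp [Derivation.commutator_apply, h D hD, h E hE]

/-- The map `f ↦ (f - f(0)) ∂_k` from polynomials to the jet Lie algebra.
It sends `t^r` to `t^r ∂_k` for `r ≠ 0`, and `1` to `0`. -/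
def jetField {n : ℕ} (k : Fin n) : Poly n →ₗ[ℂ] Jet n where
  toFun f := ⟨field k (f - C (constantCoeff f)), fun i => by
    classical
    by_cases h : i = k <;> simp [pderiv_X, Pi.single_apply, h]⟩
  map_add' f g := by
    apply Subtype.ext
    change field k _ = field k _ + field k _
    rw [← map_add]
    congr 1
    simp only [map_add]
    ring
  map_smul' c f := by
    apply Subtype.ext
    change field k _ = c • field k _
    rw [← map_smul]
    congr 1
    simp [smul_sub, smul_eq_C_mul]

/-- The Taylor expansion `f(t) ↦ f(t ⊗ 1 + 1 ⊗ t)`,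
i.e. `t^m ↦ ∑_r binom(m, r) t^{m-r} ⊗ t^r`. -/
def taylor (n : ℕ) : Poly n →ₐ[ℂ] Poly n ⊗[ℂ] Poly n :=
  aeval fun i => X i ⊗ₜ[ℂ] 1 + 1 ⊗ₜ[ℂ] X i

/-- The substitution `f(t) ↦ f(1 ⊗ t - t ⊗ 1)`,
i.e. `t^m ↦ ∑_r (-1)^{|r|} binom(m, r) t^r ⊗ t^{m-r}`. -/
def taylorInv (n : ℕ) : Poly n →ₐ[ℂ] Poly n ⊗[ℂ] Poly n :=
  aeval fun i => 1 ⊗ₜ[ℂ] X i - X i ⊗ₜ[ℂ] 1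

/-- The map `∑_k f_k ∂_k ↦ ∑_k δ(f_k) ∂_k ∈ A_n ⊗ W_n`, where `∂_k` is applied to the second
tensor factor. -/
def extend {n : ℕ} (δ : Poly n →ₐ[ℂ] Poly n ⊗[ℂ] Poly n) : Witt n →ₗ[ℂ] Poly n ⊗[ℂ] Witt n :=
  ∑ k, (field k).lTensor (Poly n) ∘ₗ δ.toLinearMap ∘ₗ comp k

lemma extend_apply {n : ℕ} (δ : Poly n →ₐ[ℂ] Poly n ⊗[ℂ] Poly n) (D : Witt n) :
    extend δ D = ∑ k, (field k).lTensor (Poly n) (δ (D (X k))) := by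
  simp [extend]

/-- The linear map `W_n → A_n ⊗ L_n` given by
`t^m ∂_k ↦ ∑_{0 ≠ r ≤ m} binom(m, r) t^{m-r} ⊗ t^r ∂_k`. -/
def jetPart (n : ℕ) : Witt n →ₗ[ℂ] Poly n ⊗[ℂ] Jet n :=
  ∑ k, (jetField k).lTensor (Poly n) ∘ₗ (taylor n).toLinearMap ∘ₗ comp k

lemma jetPart_apply {n : ℕ} (D : Witt n) :
    jetPart n D = ∑ k, (jetField k).lTensor (Poly n) (taylor n (D (X k))) := by
  simp [jetPart]

section aux

variable {n : ℕ}

lemma lTensor_pderiv_mul (i : Fin n) (P Q : Poly n ⊗[ℂ] Poly n) :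
    (pderiv i : Witt n).toLinearMap.lTensor (Poly n) (P * Q) =
      (pderiv i : Witt n).toLinearMap.lTensor (Poly n) P * Q
        + P * (pderiv i : Witt n).toLinearMap.lTensor (Poly n) Q := by
  induction P with
  | zero => simp
  | add x y hx hy => simp only [add_mul, map_add, hx, hy]; ring
  | tmul p q =>
    induction Q with
    | zero => simp
    | add x y hx hy => simp only [mul_add, map_add, hx, hy]; ring
    | tmul p' q' =>
      simp [Algebra.TensorProduct.tmul_mul_tmul, TensorProduct.tmul_add, mul_comm, add_comm]

lemma rTensor_pderiv_mul (i : Fin n) (P Q : Poly n ⊗[ℂ] Poly n) :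
    (pderiv i : Witt n).toLinearMap.rTensor (Poly n) (P * Q) =
      (pderiv i : Witt n).toLinearMap.rTensor (Poly n) P * Q
        + P * (pderiv i : Witt n).toLinearMap.rTensor (Poly n) Q := by
  induction P with
  | zero => simp
  | add x y hx hy => simp only [add_mul, map_add, hx, hy]; ring
  | tmul p q =>
    induction Q with
    | zero => simp
    | add x y hx hy => simp only [mul_add, map_add, hx, hy]; ring
    | tmul p' q' =>
      simp [Algebra.TensorProduct.tmul_mul_tmul, TensorProduct.add_tmul, mul_comm, add_comm]

lemma lTensor_taylor (i : Fin n) (f : Poly n) :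
    (pderiv i : Witt n).toLinearMap.lTensor (Poly n) (taylor n f) = taylor n (pderiv i f) := by
  classical
  induction f using MvPolynomial.induction_on with
  | C c =>
    have : taylor n (C c) = c • (1 ⊗ₜ[ℂ] 1) := by
      rw [taylor, aeval_C, Algebra.algebraMap_eq_smul_one, Algebra.TensorProduct.one_def]
    rw [this]; simp
  | add p q hp hq => simp [hp, hq]
  | mul_X p j hp =>
    rw [map_mul, lTensor_pderiv_mul, hp]
    by_cases h : j = i
    · subst h; simp [taylor, ← Algebra.TensorProduct.one_def, mul_comm, add_comm]
    · simp [taylor, pderiv_X, Pi.single_apply, h, mul_comm]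

lemma rTensor_taylor (i : Fin n) (f : Poly n) :
    (pderiv i : Witt n).toLinearMap.rTensor (Poly n) (taylor n f) = taylor n (pderiv i f) := by
  classical
  induction f using MvPolynomial.induction_on with
  | C c =>
    have : taylor n (C c) = c • (1 ⊗ₜ[ℂ] 1) := by
      rw [taylor, aeval_C, Algebra.algebraMap_eq_smul_one, Algebra.TensorProduct.one_def]
    rw [this]; simp
  | add p q hp hq => simp [hp, hq]
  | mul_X p j hp =>
    rw [map_mul, rTensor_pderiv_mul, hp]
    by_cases h : j = i
    · subst h; simp [taylor, ← Algebra.TensorProduct.one_def, mul_comm, add_comm]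
    · simp [taylor, pderiv_X, Pi.single_apply, h, mul_comm]

lemma lTensor_taylorInv (i : Fin n) (f : Poly n) :
    (pderiv i : Witt n).toLinearMap.lTensor (Poly n) (taylorInv n f)
      = taylorInv n (pderiv i f) := by
  classical
  induction f using MvPolynomial.induction_on with
  | C c =>
    have : taylorInv n (C c) = c • (1 ⊗ₜ[ℂ] 1) := by
      rw [taylorInv, aeval_C, Algebra.algebraMap_eq_smul_one, Algebra.TensorProduct.one_def]
    rw [this]; simp
  | add p q hp hq => simp [hp, hq]
  | mul_X p j hp =>
    rw [map_mul, lTensor_pderiv_mul, hp]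
    by_cases h : j = i
    · subst h; simp [taylorInv, ← Algebra.TensorProduct.one_def, mul_comm, add_comm]
    · simp [taylorInv, pderiv_X, Pi.single_apply, h, mul_comm]

lemma rTensor_taylorInv (i : Fin n) (f : Poly n) :
    (pderiv i : Witt n).toLinearMap.rTensor (Poly n) (taylorInv n f)
      = - taylorInv n (pderiv i f) := by
  classical
  induction f using MvPolynomial.induction_on with
  | C c =>
    have : taylorInv n (C c) = c • (1 ⊗ₜ[ℂ] 1) := by
      rw [taylorInv, aeval_C, Algebra.algebraMap_eq_smul_one, Algebra.TensorProduct.one_def]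
    rw [this]; simp
  | add p q hp hq => simp [hp, hq, add_comm]
  | mul_X p j hp =>
    rw [map_mul, rTensor_pderiv_mul, hp]
    by_cases h : j = i
    · subst h; simp [taylorInv, ← Algebra.TensorProduct.one_def]; ring
    · simp [taylorInv, pderiv_X, Pi.single_apply, h]; ring

lemma lie_field (i j : Fin n) (f g : Poly n) :
    ⁅field i f, field j g⁆ = field j (f * pderiv i g) - field i (g * pderiv j f) := by
  classical
  apply derivation_ext
  intro k
  by_cases h1 : k = i <;> by_cases h2 : k = j <;>
    simp [Derivation.commutator_apply, pderiv_X, Pi.single_apply, h1, h2] <;> aesop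

section bracket

variable {L V : Type*} [LieRing L] [LieAlgebra ℂ L] [AddCommGroup V] [Module ℂ V]
  [LieRingModule L V] [LieModule ℂ L V]

lemma ext_lie_add (z : Poly n ⊗[ℂ] L) (v w : Poly n ⊗[ℂ] V) : ⁅z, v + w⁆ = ⁅z, v⁆ + ⁅z, w⁆ :=
  lie_add z v w

lemma ext_add_lie (y z : Poly n ⊗[ℂ] L) (v : Poly n ⊗[ℂ] V) : ⁅y + z, v⁆ = ⁅y, v⁆ + ⁅z, v⁆ :=
  add_lie y z v

lemma ext_lie_zero (z : Poly n ⊗[ℂ] L) : ⁅z, (0 : Poly n ⊗[ℂ] V)⁆ = 0 := lie_zero z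

lemma ext_zero_lie (v : Poly n ⊗[ℂ] V) : ⁅(0 : Poly n ⊗[ℂ] L), v⁆ = 0 := zero_lie v

lemma ext_lie_sum {ι : Type*} (s : Finset ι) (z : Poly n ⊗[ℂ] L) (v : ι → Poly n ⊗[ℂ] V) :
    ⁅z, ∑ i ∈ s, v i⁆ = ∑ i ∈ s, ⁅z, v i⁆ := lie_sum s v z

lemma ext_sum_lie {ι : Type*} (s : Finset ι) (z : ι → Poly n ⊗[ℂ] L) (v : Poly n ⊗[ℂ] V) :
    ⁅∑ i ∈ s, z i, v⁆ = ∑ i ∈ s, ⁅z i, v⁆ := sum_lie s z v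

lemma ext_tmul (p q : Poly n) (x : L) (v : V) :
    ⁅p ⊗ₜ[ℂ] x, q ⊗ₜ[ℂ] v⁆ = (p * q) ⊗ₜ[ℂ] ⁅x, v⁆ := rfl

end bracket

lemma lie_lTensor_field (i j : Fin n) (P Q : Poly n ⊗[ℂ] Poly n) :
    ⁅(field i).lTensor (Poly n) P, (field j).lTensor (Poly n) Q⁆ =
      (field j).lTensor (Poly n) (P * (pderiv i : Witt n).toLinearMap.lTensor (Poly n) Q)
      - (field i).lTensor (Poly n) (Q * (pderiv j : Witt n).toLinearMap.lTensor (Poly n) P) := by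
  induction P with
  | zero => simp [ext_zero_lie]
  | add x y hx hy => simp only [add_mul, mul_add, map_add, ext_add_lie, hx, hy]; abel
  | tmul p q =>
    induction Q with
    | zero => simp [ext_lie_zero]
    | add x y hx hy => simp only [add_mul, mul_add, map_add, ext_lie_add, hx, hy]; abel
    | tmul p' q' =>
      simp only [LinearMap.lTensor_tmul, ext_tmul, lie_field,
        Algebra.TensorProduct.tmul_mul_tmul, TensorProduct.tmul_sub, mul_comm p' p]
      rfl

lemma extend_lie (δ : Poly n →ₐ[ℂ] Poly n ⊗[ℂ] Poly n)
    (h : ∀ i f, (pderiv i : Witt n).toLinearMap.lTensor (Poly n) (δ f) = δ (pderiv i f))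
    (D E : Witt n) : extend δ ⁅D, E⁆ = ⁅extend δ D, extend δ E⁆ := by
  have e : ∀ D E : Witt n, ∑ k, (field k).lTensor (Poly n) (δ (D (E (X k)))) =
      ∑ k, ∑ i, (field k).lTensor (Poly n) (δ (D (X i) * pderiv i (E (X k)))) := by
    intro D E
    refine Finset.sum_congr rfl fun k _ => ?_
    rw [witt_apply D, map_sum, map_sum]
  have e0 : extend δ ⁅D, E⁆ = ∑ k, (field k).lTensor (Poly n) (δ (D (E (X k))))
      - ∑ k, (field k).lTensor (Poly n) (δ (E (D (X k)))) := by
    rw [extend_apply, ← Finset.sum_sub_distrib]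
    refine Finset.sum_congr rfl fun k _ => ?_
    rw [Derivation.commutator_apply, map_sub, map_sub]
  rw [e0, e, e, extend_apply, extend_apply]
  simp only [ext_sum_lie, ext_lie_sum, lie_lTensor_field, h, ← map_mul, Finset.sum_sub_distrib]
  rw [sub_eq_sub_iff_add_eq_add]
  exact congrArg₂ (· + ·) rfl Finset.sum_comm

/-- `X ↦ ∑_k X(t_k) ⊗ ∂_k`. -/
def constPart (n : ℕ) : Witt n →ₗ[ℂ] Poly n ⊗[ℂ] Witt n :=
  extend Algebra.TensorProduct.includeLeft

lemma constPart_apply (D : Witt n) :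
    constPart n D = ∑ k, D (X k) ⊗ₜ[ℂ] (pderiv k : Witt n) := by
  simp [constPart, extend_apply]

lemma pderiv_lie_pderiv (i j : Fin n) : ⁅(pderiv i : Witt n), (pderiv j : Witt n)⁆ = 0 := by
  have := lie_field i j (1 : Poly n) 1
  simpa using this

lemma ext_skew {L : Type*} [LieRing L] [LieAlgebra ℂ L] (y z : Poly n ⊗[ℂ] L) :
    ⁅y, z⁆ = -⁅z, y⁆ := by
  induction y with
  | zero => simp [ext_zero_lie, ext_lie_zero]
  | add x y hx hy => rw [ext_add_lie, ext_lie_add, hx, hy]; abel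
  | tmul p x =>
    induction z with
    | zero => simp [ext_zero_lie, ext_lie_zero]
    | add x y hx hy => rw [ext_add_lie, ext_lie_add, hx, hy]; abel
    | tmul q y => rw [ext_tmul, ext_tmul, ← lie_skew x y, TensorProduct.tmul_neg, mul_comm]

lemma ext_sub_lie {L : Type*} [LieRing L] [LieAlgebra ℂ L] (x y z : Poly n ⊗[ℂ] L) :
    ⁅x - y, z⁆ = ⁅x, z⁆ - ⁅y, z⁆ :=
  eq_sub_of_add_eq (by rw [← ext_add_lie, sub_add_cancel])

lemma ext_lie_sub {L : Type*} [LieRing L] [LieAlgebra ℂ L] (x y z : Poly n ⊗[ℂ] L) :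
    ⁅x, y - z⁆ = ⁅x, y⁆ - ⁅x, z⁆ :=
  eq_sub_of_add_eq (by rw [← ext_lie_add, sub_add_cancel])

lemma constPart_lie (D E : Witt n) : ⁅constPart n D, constPart n E⁆ = 0 := by
  simp only [constPart_apply, ext_sum_lie, ext_lie_sum, ext_tmul, pderiv_lie_pderiv]
  simp

lemma constPart_lie_eq (D E : Witt n) :
    constPart n ⁅D, E⁆ = D.toLinearMap.rTensor _ (constPart n E)
      - E.toLinearMap.rTensor _ (constPart n D) := by
  simp only [constPart_apply, map_sum, LinearMap.rTensor_tmul, ← Finset.sum_sub_distrib,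
    ← TensorProduct.sub_tmul]
  rfl

lemma constPart_lie_extend (D E : Witt n) :
    ⁅constPart n D, extend (taylor n) E⁆
      = D.toLinearMap.rTensor _ (extend (taylor n) E) := by
  have key : ∀ (i k : Fin n) (f : Poly n) (P : Poly n ⊗[ℂ] Poly n),
      ⁅f ⊗ₜ[ℂ] (pderiv i : Witt n), (field k).lTensor (Poly n) P⁆ =
        (field k).lTensor (Poly n)
          (f ⊗ₜ[ℂ] 1 * (pderiv i : Witt n).toLinearMap.lTensor (Poly n) P) := by
    intro i k f P
    have := lie_lTensor_field i k (f ⊗ₜ[ℂ] 1) P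
    simpa using this
  have hD : ∀ P : Poly n ⊗[ℂ] Poly n, D.toLinearMap.rTensor (Poly n) P =
      ∑ i, D (X i) ⊗ₜ[ℂ] 1 * (pderiv i : Witt n).toLinearMap.rTensor (Poly n) P := by
    intro P
    induction P with
    | zero => simp
    | add x y hx hy => simp only [map_add, hx, hy, mul_add, Finset.sum_add_distrib]
    | tmul p q =>
      simp only [LinearMap.rTensor_tmul, Derivation.coeFn_coe, Algebra.TensorProduct.tmul_mul_tmul,
        one_mul, ← TensorProduct.sum_tmul]
      rw [witt_apply D p]
  have hc : ∀ (k : Fin n) (P : Poly n ⊗[ℂ] Poly n), D.toLinearMap.rTensor (Witt n)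
      ((field k).lTensor (Poly n) P) = (field k).lTensor (Poly n)
        (D.toLinearMap.rTensor (Poly n) P) := by
    intro k P
    rw [← LinearMap.comp_apply, ← LinearMap.comp_apply, LinearMap.rTensor_comp_lTensor,
      LinearMap.lTensor_comp_rTensor]
  simp only [constPart_apply, extend_apply, ext_sum_lie, ext_lie_sum, key, map_sum, hc, hD,
    lTensor_taylor, rTensor_taylor]

/-- The inclusion `L_n ⊆ W_n`. -/
def jetIncl (n : ℕ) : Jet n →ₗ[ℂ] Witt n := (Jet n).incl

lemma incl_jetPart (D : Witt n) :
    (jetIncl n).lTensor (Poly n) (jetPart n D)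
      = extend (taylor n) D - constPart n D := by
  have h0 : ∀ f : Poly n, ((Algebra.ofId ℂ (Poly n)).comp
      (aeval (fun _ => 0))).toLinearMap.lTensor (Poly n) (taylor n f) = f ⊗ₜ[ℂ] 1 := by
    intro f
    have : (Algebra.TensorProduct.map (AlgHom.id ℂ (Poly n)) ((Algebra.ofId ℂ (Poly n)).comp
      (aeval (fun _ => 0)))).comp (taylor n) = Algebra.TensorProduct.includeLeft := by
      apply MvPolynomial.algHom_ext
      intro i
      simp [taylor]
    exact DFunLike.congr_fun this f
  have h1 : ∀ (k : Fin n) (P : Poly n ⊗[ℂ] Poly n),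
      (jetIncl n).lTensor (Poly n) ((jetField k).lTensor (Poly n) P) =
        (field k).lTensor (Poly n) P - (field k).lTensor (Poly n)
          (((Algebra.ofId ℂ (Poly n)).comp
      (aeval (fun _ => 0))).toLinearMap.lTensor (Poly n) P) := by
    intro k P
    induction P with
    | zero => simp
    | add x y hx hy => simp only [map_add, hx, hy]; abel
    | tmul p q =>
      simp only [LinearMap.lTensor_tmul, ← TensorProduct.tmul_sub, ← map_sub]
      congr 1
      change field k _ = _
      congr 2
      simp [Algebra.ofId_apply, MvPolynomial.algebraMap_eq]
  simp only [jetPart_apply, extend_apply, constPart_apply, map_sum, h1, h0,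
    Finset.sum_sub_distrib, LinearMap.lTensor_tmul, field_apply, one_smul]

lemma incl_lie (y z : Poly n ⊗[ℂ] Jet n) :
    (jetIncl n).lTensor (Poly n) ⁅y, z⁆ =
      ⁅(jetIncl n).lTensor (Poly n) y,
        (jetIncl n).lTensor (Poly n) z⁆ := by
  induction y with
  | zero => simp [ext_zero_lie]
  | add x y hx hy => simp only [map_add, ext_add_lie, hx, hy]
  | tmul p q =>
    induction z with
    | zero => simp [ext_lie_zero]
    | add x y hx hy => simp only [map_add, ext_lie_add, hx, hy]
    | tmul p' q' => simp only [LinearMap.lTensor_tmul, ext_tmul]; rfl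

lemma jetPart_lie (D E : Witt n) :
    jetPart n ⁅D, E⁆ = D.toLinearMap.rTensor _ (jetPart n E)
      - E.toLinearMap.rTensor _ (jetPart n D) + ⁅jetPart n D, jetPart n E⁆ := by
  have hinj : Function.Injective ((jetIncl n).lTensor (Poly n)) :=
    Module.Flat.lTensor_preserves_injective_linearMap _ Subtype.val_injective
  have hc : ∀ (D : Witt n) z, (jetIncl n).lTensor (Poly n)
      (D.toLinearMap.rTensor _ z) = D.toLinearMap.rTensor _
        ((jetIncl n).lTensor (Poly n) z) := by
    intro D z
    rw [← LinearMap.comp_apply, ← LinearMap.comp_apply, LinearMap.rTensor_comp_lTensor,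
      LinearMap.lTensor_comp_rTensor]
  have sk : ⁅extend (taylor n) D, constPart n E⁆ = - ⁅constPart n E, extend (taylor n) D⁆ :=
    ext_skew _ _
  have hl : ∀ x y z w : Poly n ⊗[ℂ] Witt n, ⁅x - y, z - w⁆ = ⁅x, z⁆ - ⁅x, w⁆ - ⁅y, z⁆ + ⁅y, w⁆ := by
    intro x y z w
    rw [ext_sub_lie, ext_lie_sub, ext_lie_sub]; abel
  apply hinj
  simp only [map_add, map_sub, hc, incl_lie, incl_jetPart, hl, sk, constPart_lie,
    constPart_lie_extend, constPart_lie_eq, extend_lie _ lTensor_taylor]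
  abel

lemma jetPart_pderiv (i : Fin n) : jetPart n (pderiv i) = 0 := by
  rw [jetPart_apply]
  refine Finset.sum_eq_zero fun k _ => ?_
  have h1 : jetField k (1 : Poly n) = 0 := by
    apply Subtype.ext
    change field k _ = 0
    simp
  classical
  by_cases h : k = i
  · subst h
    simp [Algebra.TensorProduct.one_def, h1]
  · simp [pderiv_X, h]

end aux

/-! ### `(A_n, W_n)`-modules and Whittaker vectors -/

/-- `M` is an `(A_n, W_n)`-module: a complex vector space with a (unital, associative) `A_n`-module
structure and a `W_n`-module structure which together form a module over `W_n ⋉ A_n`,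
i.e. `X (f v) - f (X v) = X(f) v`. -/
class IsAWModule (n : ℕ) (M : Type*) [AddCommGroup M] [Module ℂ M] [Module (Poly n) M]
    [LieRingModule (Witt n) M] : Prop
    extends IsScalarTower ℂ (Poly n) M, LieModule ℂ (Witt n) M where
  lie_smul_poly : ∀ (D : Witt n) (f : Poly n) (v : M), ⁅D, f • v⁆ = D f • v + f • ⁅D, v⁆

/-- The space `Wh_a(M) = {v | ∂_i v = a_i v for all i}` of Whittaker vectors. -/
def Wh {n : ℕ} (a : Fin n → ℂ) (M : Type*) [AddCommGroup M] [Module ℂ M]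
    [LieRingModule (Witt n) M] [LieModule ℂ (Witt n) M] : Submodule ℂ M where
  carrier := {v | ∀ i, ⁅(pderiv i : Witt n), v⁆ = a i • v}
  add_mem' := by
    intro v w hv hw i
    rw [lie_add, hv i, hw i, smul_add]
  zero_mem' := by intro i; simp
  smul_mem' := by
    intro c v hv i
    rw [lie_smul, hv i, smul_comm]

/-- `M` is a Whittaker module of type `φ_a`, where `φ_a(∑ c_i ∂_i) = ∑ c_i a_i`: for every `v`
there is a `k` such that `(x - φ_a(x))^k v = 0` for all `x` in `Δ_n = span{∂_1, …, ∂_n}`. -/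
def IsWhittaker {n : ℕ} (a : Fin n → ℂ) (M : Type*) [AddCommGroup M] [Module ℂ M]
    [LieRingModule (Witt n) M] [LieModule ℂ (Witt n) M] : Prop :=
  ∀ v : M, ∃ k : ℕ, ∀ c : Fin n → ℂ,
    ((LieModule.toEnd ℂ (Witt n) M (∑ i, c i • (pderiv i : Witt n))
      - (∑ i, c i * a i) • (1 : Module.End ℂ M)) ^ k) v = 0

/-! ### The `(A_n, W_n)`-module `T(A_n^a, V)` -/

/-- The action of a vector field on `A_n^a`, the `𝓓_n`-module `A_n` twisted by `t_i ↦ t_i`,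
`∂_i ↦ ∂_i + a_i`: the field `X = ∑ f_k ∂_k` sends `p` to `∑ f_k (∂_k p + a_k p)`. -/
def twist {n : ℕ} (a : Fin n → ℂ) (D : Witt n) : Poly n →ₗ[ℂ] Poly n :=
  D.toLinearMap + LinearMap.mulLeft ℂ (∑ k, a k • D (X k))

lemma twist_apply {n : ℕ} (a : Fin n → ℂ) (D : Witt n) (p : Poly n) :
    twist a D p = D p + (∑ k, a k • D (X k)) * p := rfl

/-- The vector space `A_n^a ⊗ V` underlying `T(A_n^a, V)`. -/
def T {n : ℕ} (_a : Fin n → ℂ) (V : Type u) [AddCommGroup V] [Module ℂ V] : Type u :=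
  Poly n ⊗[ℂ] V

namespace T

variable {n : ℕ} (a : Fin n → ℂ) (V : Type u) [AddCommGroup V] [Module ℂ V]

instance : AddCommGroup (T a V) := inferInstanceAs (AddCommGroup (Poly n ⊗[ℂ] V))

instance : Module ℂ (T a V) := inferInstanceAs (Module ℂ (Poly n ⊗[ℂ] V))

/-- `A_n` acts on `A_n^a ⊗ V` by multiplication on the first factor. -/
instance : Module (Poly n) (T a V) := inferInstanceAs (Module (Poly n) (Poly n ⊗[ℂ] V))

instance : IsScalarTower ℂ (Poly n) (T a V) :=
  inferInstanceAs (IsScalarTower ℂ (Poly n) (Poly n ⊗[ℂ] V))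

variable [LieRingModule (Jet n) V] [LieModule ℂ (Jet n) V]

/-- The action of `W_n` on `A_n^a ⊗ V`:
`t^m ∂_k (p ⊗ v) = (t^m ∂_k · p) ⊗ v + ∑_{0 ≠ r ≤ m} binom(m, r) t^{m-r} p ⊗ (t^r ∂_k) v`.
The bracket on the right is the action `⁅q ⊗ x, p ⊗ v⁆ = q p ⊗ x v` of `A_n ⊗ L_n`. -/
def act (D : Witt n) (w : Poly n ⊗[ℂ] V) : Poly n ⊗[ℂ] V :=
  (twist a D).rTensor V w + ⁅jetPart n D, w⁆

variable {V}

lemma twist_add (D E : Witt n) : twist a (D + E) = twist a D + twist a E := by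
  refine LinearMap.ext fun p => ?_
  simp only [twist_apply, LinearMap.add_apply, Derivation.add_apply, smul_add,
    Finset.sum_add_distrib]
  ring

lemma twist_smul (c : ℂ) (D : Witt n) : twist a (c • D) = c • twist a D := by
  refine LinearMap.ext fun p => ?_
  simp only [twist_apply, LinearMap.smul_apply, Derivation.smul_apply, smul_add,
    smul_comm _ c, ← Finset.smul_sum, smul_mul_assoc]

lemma twist_lie (D E : Witt n) (p : Poly n) :
    twist a ⁅D, E⁆ p = twist a D (twist a E p) - twist a E (twist a D p) := by
  simp only [twist_apply, map_add, Derivation.leibniz, Derivation.commutator_apply, smul_sub,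
    Finset.sum_sub_distrib, map_sum, smul_eq_mul, Derivation.map_smul]
  ring

lemma twist_mul (D : Witt n) (f p : Poly n) :
    twist a D (f * p) = D f * p + f * twist a D p := by
  simp only [twist_apply, Derivation.leibniz, smul_eq_mul]
  ring

lemma lie_tensor (y z : Poly n ⊗[ℂ] Jet n) (w : Poly n ⊗[ℂ] V) :
    ⁅⁅y, z⁆, w⁆ = ⁅y, ⁅z, w⁆⁆ - ⁅z, ⁅y, w⁆⁆ := by
  induction w with
  | zero => simp [ext_lie_zero]
  | add x y hx hy => simp only [ext_lie_add, hx, hy]; abel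
  | tmul p v =>
    induction y with
    | zero => simp [ext_zero_lie, ext_lie_zero]
    | add x y hx hy => simp only [ext_add_lie, ext_lie_add, hx, hy]; abel
    | tmul q x =>
      induction z with
      | zero => simp [ext_zero_lie, ext_lie_zero]
      | add x y hx hy => simp only [ext_add_lie, ext_lie_add, hx, hy]; abel
      | tmul r y =>
        simp only [ext_tmul, lie_lie, TensorProduct.tmul_sub, mul_left_comm r q p, mul_assoc]

lemma rTensor_twist_lie (D : Witt n) (z : Poly n ⊗[ℂ] Jet n) (w : Poly n ⊗[ℂ] V) :
    (twist a D).rTensor V ⁅z, w⁆ =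
      ⁅D.toLinearMap.rTensor _ z, w⁆ + ⁅z, (twist a D).rTensor V w⁆ := by
  induction w with
  | zero => simp [ext_lie_zero]
  | add x y hx hy => simp only [ext_lie_add, map_add, hx, hy]; abel
  | tmul p v =>
    induction z with
    | zero => simp [ext_zero_lie]
    | add x y hx hy => simp only [ext_add_lie, map_add, hx, hy]; abel
    | tmul q x =>
      simp only [ext_tmul, LinearMap.rTensor_tmul, twist_mul, TensorProduct.add_tmul]
      rfl

lemma act_lie (D E : Witt n) (w : Poly n ⊗[ℂ] V) :
    act a V ⁅D, E⁆ w = act a V D (act a V E w) - act a V E (act a V D w) := by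
  have h : (twist a ⁅D, E⁆).rTensor V w = (twist a D).rTensor V ((twist a E).rTensor V w)
      - (twist a E).rTensor V ((twist a D).rTensor V w) := by
    induction w with
    | zero => simp
    | add x y hx hy => simp only [map_add, hx, hy]; abel
    | tmul p v => simp only [LinearMap.rTensor_tmul, twist_lie, TensorProduct.sub_tmul]
  have hs : ∀ x y z : Poly n ⊗[ℂ] Jet n, ⁅x - y + z, w⁆ = ⁅x, w⁆ - ⁅y, w⁆ + ⁅z, w⁆ := by
    intro x y z
    rw [ext_add_lie]
    congr 1
    exact eq_sub_of_add_eq (by rw [← ext_add_lie, sub_add_cancel])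
  simp only [act, h, jetPart_lie, hs, lie_tensor, map_add, ext_lie_add, rTensor_twist_lie]
  abel

variable (V)

lemma ext_smul_poly (z : Poly n ⊗[ℂ] Jet n) (f : Poly n) (w : Poly n ⊗[ℂ] V) :
    ⁅z, f • w⁆ = f • ⁅z, w⁆ := by
  induction w with
  | zero => simp [ext_lie_zero]
  | add x y hx hy => simp only [ext_lie_add, smul_add, hx, hy]
  | tmul p v =>
    induction z with
    | zero => simp [ext_zero_lie]
    | add x y hx hy => simp only [ext_add_lie, smul_add, hx, hy]
    | tmul q x =>
      simp only [ext_tmul, TensorProduct.smul_tmul', smul_eq_mul, mul_left_comm]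

lemma ext_smul (z : Poly n ⊗[ℂ] Jet n) (c : ℂ) (w : Poly n ⊗[ℂ] V) :
    ⁅z, c • w⁆ = c • ⁅z, w⁆ := by
  have := ext_smul_poly V z (C c) w
  simpa only [← MvPolynomial.algebraMap_eq, algebraMap_smul] using this

lemma smul_ext (z : Poly n ⊗[ℂ] Jet n) (c : ℂ) (w : Poly n ⊗[ℂ] V) :
    ⁅c • z, w⁆ = c • ⁅z, w⁆ := by
  induction w with
  | zero => simp [ext_lie_zero]
  | add x y hx hy => simp only [ext_lie_add, smul_add, hx, hy]
  | tmul p v =>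
    induction z with
    | zero => simp [ext_zero_lie]
    | add x y hx hy => simp only [ext_add_lie, smul_add, hx, hy]
    | tmul q x =>
      simp only [ext_tmul, TensorProduct.smul_tmul', smul_mul_assoc]

lemma add_act (D E : Witt n) (w : Poly n ⊗[ℂ] V) :
    act a V (D + E) w = act a V D w + act a V E w := by
  simp only [act, twist_add, map_add, LinearMap.rTensor_add, LinearMap.add_apply, ext_add_lie]
  abel

lemma act_add (D : Witt n) (v w : Poly n ⊗[ℂ] V) :
    act a V D (v + w) = act a V D v + act a V D w := by
  simp only [act, map_add, ext_lie_add]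
  abel

lemma smul_act (c : ℂ) (D : Witt n) (w : Poly n ⊗[ℂ] V) :
    act a V (c • D) w = c • act a V D w := by
  simp only [act, twist_smul, map_smul, LinearMap.rTensor_smul, LinearMap.smul_apply, smul_ext,
    smul_add]

lemma act_smul (c : ℂ) (D : Witt n) (w : Poly n ⊗[ℂ] V) :
    act a V D (c • w) = c • act a V D w := by
  simp only [act, map_smul, ext_smul, smul_add]

lemma act_smul_poly (D : Witt n) (f : Poly n) (w : Poly n ⊗[ℂ] V) :
    act a V D (f • w) = D f • w + f • act a V D w := by
  have h : ∀ w : Poly n ⊗[ℂ] V,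
      (twist a D).rTensor V (f • w) = D f • w + f • (twist a D).rTensor V w := by
    intro w
    induction w with
    | zero => simp
    | add x y hx hy => simp only [map_add, smul_add, hx, hy]; abel
    | tmul p v =>
      simp only [LinearMap.rTensor_tmul, TensorProduct.smul_tmul', smul_eq_mul, twist_mul,
        TensorProduct.add_tmul]
  simp only [act, h, ext_smul_poly, smul_add]
  abel

instance : LieRingModule (Witt n) (T a V) where
  bracket D w := act a V D w
  add_lie := add_act a V
  lie_add := act_add a V
  leibniz_lie D E w := sub_eq_iff_eq_add.1 (act_lie a D E w).symm

instance : LieModule ℂ (Witt n) (T a V) where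
  smul_lie := smul_act a V
  lie_smul := act_smul a V

instance : IsAWModule n (T a V) where
  lie_smul_poly := act_smul_poly a V

/-- The field `∂_i` acts on `A_n^a ⊗ V` by `∂_i + a_i` on the first factor. -/
lemma act_pderiv (i : Fin n) (w : Poly n ⊗[ℂ] V) :
    act a V (pderiv i) w = (pderiv i : Witt n).toLinearMap.rTensor V w + a i • w := by
  classical
  rw [act, jetPart_pderiv, ext_zero_lie, add_zero]
  have : twist a (pderiv i) = (pderiv i : Witt n).toLinearMap + a i • LinearMap.id := by
    refine LinearMap.ext fun p => ?_
    rw [twist_apply, Finset.sum_eq_single i]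
    · simp
    · intro k _ hk
      simp [pderiv_X, hk]
    · simp
  rw [this, LinearMap.rTensor_add, LinearMap.rTensor_smul]
  simp

/-- Directional derivatives are uniformly locally nilpotent. -/
lemma exists_pow_eq_zero (p : Poly n) : ∃ k : ℕ, ∀ c : Fin n → ℂ,
    ((∑ i, c i • (pderiv i : Witt n).toLinearMap) ^ k) p = 0 := by
  classical
  induction p using MvPolynomial.induction_on with
  | C c =>
    refine ⟨1, fun c => ?_⟩
    simp [LinearMap.sum_apply]
  | add p q hp hq =>
    obtain ⟨k, hk⟩ := hp
    obtain ⟨l, hl⟩ := hq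
    refine ⟨k + l, fun c => ?_⟩
    have h1 := hk c
    have h2 := hl c
    generalize (∑ i, c i • (pderiv i : Witt n).toLinearMap) = d at *
    have e1 : (d ^ (k + l)) p = 0 := by
      rw [add_comm, pow_add, Module.End.mul_apply, h1, map_zero]
    have e2 : (d ^ (k + l)) q = 0 := by
      rw [pow_add, Module.End.mul_apply, h2, map_zero]
    rw [map_add, e1, e2, add_zero]
  | mul_X p j hp =>
    obtain ⟨k, hk⟩ := hp
    refine ⟨k + 1, fun c => ?_⟩
    set d : Module.End ℂ (Poly n) := ∑ i, c i • (pderiv i : Witt n).toLinearMap with hd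
    have hl : ∀ q, d (q * X j) = d q * X j + c j • q := by
      intro q
      simp only [hd, LinearMap.sum_apply, LinearMap.smul_apply, Derivation.coeFn_coe,
        Derivation.leibniz, smul_add, Finset.sum_add_distrib, smul_eq_mul, Finset.sum_mul]
      rw [add_comm]
      congr 1
      · refine Finset.sum_congr rfl fun i _ => ?_
        rw [mul_comm, smul_mul_assoc]
      · rw [Finset.sum_eq_single j]
        · simp
        · intro i _ hi
          simp [pderiv_X, hi.symm]
        · simp
    have key : ∀ m : ℕ, (d ^ (m + 1)) (p * X j) =
        (d ^ (m + 1)) p * X j + ((m + 1 : ℂ) * c j) • (d ^ m) p := by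
      intro m
      induction m with
      | zero => simp [hl]
      | succ m ih =>
        rw [pow_succ' d (m + 1), Module.End.mul_apply, ih, map_add, hl, map_smul,
          Module.End.mul_apply, pow_succ' d m, Module.End.mul_apply, add_assoc, ← add_smul]
        congr 2
        push_cast
        ring
    rw [key, pow_succ', Module.End.mul_apply, hk c]
    simp

lemma rTensor_sum_pderiv (c : Fin n → ℂ) (w : Poly n ⊗[ℂ] V) :
    (∑ i, c i • (pderiv i : Witt n).toLinearMap).rTensor V w
      = ∑ i, c i • (pderiv i : Witt n).toLinearMap.rTensor V w := by
  induction w with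
  | zero => simp
  | add x y hx hy => simp only [map_add, smul_add, hx, hy, Finset.sum_add_distrib]
  | tmul p v =>
    simp [LinearMap.sum_apply, TensorProduct.sum_tmul, TensorProduct.smul_tmul']

lemma isWhittaker : IsWhittaker a (T a V) := by
  let φ : T a V ≃ₗ[ℂ] Poly n ⊗[ℂ] V := LinearEquiv.refl ℂ (Poly n ⊗[ℂ] V)
  have hφ : ∀ (D : Witt n) (w : T a V), φ ⁅D, w⁆ = act a V D (φ w) := fun _ _ => rfl
  have hact : ∀ (c : Fin n → ℂ) (w : T a V),
      φ ((LieModule.toEnd ℂ (Witt n) (T a V) (∑ i, c i • (pderiv i : Witt n))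
        - (∑ i, c i * a i) • (1 : Module.End ℂ (T a V))) w)
        = (∑ i, c i • (pderiv i : Witt n).toLinearMap).rTensor V (φ w) := by
    intro c w
    have h1 : φ (((∑ i, c i * a i) • (1 : Module.End ℂ (T a V))) w) = (∑ i, c i * a i) • φ w := by
      rw [LinearMap.smul_apply, Module.End.one_apply, map_smul]
    rw [rTensor_sum_pderiv, map_sum, LinearMap.sub_apply, LinearMap.sum_apply, map_sub, map_sum,
      h1]
    simp only [map_smul, LinearMap.smul_apply, LieModule.toEnd_apply_apply, hφ, act_pderiv,
      smul_add, Finset.sum_add_distrib, Finset.sum_smul, mul_smul]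
    exact add_sub_cancel_right _ _
  have hpow : ∀ (c : Fin n → ℂ) (k : ℕ) (w : T a V),
      φ (((LieModule.toEnd ℂ (Witt n) (T a V) (∑ i, c i • (pderiv i : Witt n))
        - (∑ i, c i * a i) • (1 : Module.End ℂ (T a V))) ^ k) w)
        = ((∑ i, c i • (pderiv i : Witt n).toLinearMap) ^ k).rTensor V (φ w) := by
    intro c k
    induction k with
    | zero => intro w; simp [Module.End.one_eq_id]
    | succ k ih =>
      intro w
      rw [pow_succ, Module.End.mul_apply, ih, hact, pow_succ, Module.End.mul_eq_comp,
        LinearMap.rTensor_comp, LinearMap.comp_apply]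
  have main : ∀ w : Poly n ⊗[ℂ] V, ∃ k : ℕ, ∀ c : Fin n → ℂ,
      ((∑ i, c i • (pderiv i : Witt n).toLinearMap) ^ k).rTensor V w = 0 := by
    intro w
    induction w with
    | zero => exact ⟨0, fun c => by simp⟩
    | add x y hx hy =>
      obtain ⟨k, hk⟩ := hx
      obtain ⟨l, hl⟩ := hy
      refine ⟨k + l, fun c => ?_⟩
      have h1 := hk c
      have h2 := hl c
      generalize (∑ i, c i • (pderiv i : Witt n).toLinearMap) = d at *
      have e1 : (d ^ (k + l)).rTensor V x = 0 := by
        rw [add_comm, pow_add, Module.End.mul_eq_comp, LinearMap.rTensor_comp,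
          LinearMap.comp_apply, h1, map_zero]
      have e2 : (d ^ (k + l)).rTensor V y = 0 := by
        rw [pow_add, Module.End.mul_eq_comp, LinearMap.rTensor_comp, LinearMap.comp_apply,
          h2, map_zero]
      rw [map_add, e1, e2, add_zero]
    | tmul p v =>
      obtain ⟨k, hk⟩ := exists_pow_eq_zero p
      exact ⟨k, fun c => by rw [LinearMap.rTensor_tmul, hk c, TensorProduct.zero_tmul]⟩
  intro w
  obtain ⟨k, hk⟩ := main (φ w)
  exact ⟨k, fun c => φ.map_eq_zero_iff.1 ((hpow c k w).trans (hk c))⟩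

lemma eq_C_of_pderiv_eq_zero (p : Poly n) (h : ∀ i, pderiv i p = 0) : p = C (coeff 0 p) := by
  classical
  ext m
  rw [coeff_C]
  split_ifs with hm
  · rw [hm]
  · obtain ⟨i, hi⟩ : ∃ i, m i ≠ 0 := by
      by_contra! hc
      exact hm (Finsupp.ext fun i => (hc i).symm)
    have h1 := congrArg (coeff (m - Finsupp.single i 1)) (h i)
    rw [coeff_pderiv, coeff_zero] at h1
    have h2 : m - Finsupp.single i 1 + Finsupp.single i 1 = m :=
      tsub_add_cancel_of_le (by
        rw [Finsupp.single_le_iff]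
        omega)
    rw [h2] at h1
    rcases mul_eq_zero.1 h1 with h3 | h3
    · exact h3
    · exact absurd h3 (Nat.cast_add_one_ne_zero _)

/-- The map `v ↦ 1 ⊗ v`. -/
def one : V →ₗ[ℂ] T a V := TensorProduct.mk ℂ (Poly n) V 1

/-- The Whittaker vectors of `A_n^a ⊗ V` lie in `1 ⊗ V`. -/
lemma Wh_le : Wh a (T a V) ≤ LinearMap.range (one a V) := by
  intro w hw
  change Poly n ⊗[ℂ] V at w
  have hw' : ∀ i, (pderiv i : Witt n).toLinearMap.rTensor V w = 0 := by
    intro i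
    have h1 : act a V (pderiv i) w = a i • w := hw i
    rw [act_pderiv] at h1
    exact add_eq_right.1 h1
  let b := Module.Basis.ofVectorSpace ℂ V
  have hrep : ∀ (d : Poly n →ₗ[ℂ] Poly n) (w : Poly n ⊗[ℂ] V) j,
      (b.baseChange (Poly n)).repr (d.rTensor V w) j = d ((b.baseChange (Poly n)).repr w j) := by
    intro d w j
    induction w with
    | zero => simp
    | add x y hx hy => simp only [map_add, Finsupp.add_apply, hx, hy]
    | tmul p v => simp [Module.Basis.baseChange_repr_tmul]
  have hc : ∀ j, (b.baseChange (Poly n)).repr w j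
      = C (coeff 0 ((b.baseChange (Poly n)).repr w j)) := by
    intro j
    refine eq_C_of_pderiv_eq_zero _ fun i => ?_
    have := hrep (pderiv i : Witt n).toLinearMap w j
    rw [hw' i] at this
    simpa using this.symm
  rw [← (b.baseChange (Poly n)).linearCombination_repr w, Finsupp.linearCombination_apply,
    Finsupp.sum]
  refine Submodule.sum_mem _ fun j _ => ?_
  rw [hc j, ← MvPolynomial.algebraMap_eq, algebraMap_smul, Module.Basis.baseChange_apply]
  exact Submodule.smul_mem _ _ ⟨b j, rfl⟩

instance [FiniteDimensional ℂ V] : FiniteDimensional ℂ (Wh a (T a V)) :=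
  have : FiniteDimensional ℂ (LinearMap.range (one a V)) := Module.Finite.range _
  Submodule.finiteDimensional_of_le (Wh_le a V)

end T

/-! ### The action of `L_n` on the space of Whittaker vectors -/

section WhAction

variable {n : ℕ} (M : Type*) [AddCommGroup M] [Module ℂ M] [Module (Poly n) M]
  [LieRingModule (Witt n) M] [IsAWModule n M]

/-- The operators `f ⊗ X : v ↦ f (X v)` on an `(A_n, W_n)`-module. -/
def smash : Poly n ⊗[ℂ] Witt n →ₗ[ℂ] Module.End ℂ M :=
  TensorProduct.lift ((LinearMap.mul ℂ (Module.End ℂ M)).compl₁₂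
    (Algebra.lsmul ℂ ℂ M).toLinearMap (LieModule.toEnd ℂ (Witt n) M : Witt n →ₗ[ℂ] _))

@[simp] lemma smash_tmul (f : Poly n) (D : Witt n) (v : M) :
    smash M (f ⊗ₜ[ℂ] D) v = f • ⁅D, v⁆ := rfl

/-- The operators through which `L_n` acts on an `(A_n, W_n)`-module: `t^m ∂_k` sends `v` to
`∑_{r ≤ m} (-1)^{|r|} binom(m, r) t^r ((t^{m-r} ∂_k) v)`. These correspond to `1 ⊗ L_n` under the
isomorphism `A_n # U(W_n) ≅ 𝓓_n ⊗ U(L_n)`. -/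
def jetOp (D : Witt n) : Module.End ℂ M := smash M (extend (taylorInv n) D)

/-- The anchor map `f ⊗ X ↦ f X`. -/
def anchor (n : ℕ) : Poly n ⊗[ℂ] Witt n →ₗ[ℂ] Witt n :=
  TensorProduct.lift ((Algebra.lsmul ℂ ℂ (Witt n)).toLinearMap :
    Poly n →ₗ[ℂ] Module.End ℂ (Witt n))

@[simp] lemma anchor_tmul (f : Poly n) (D : Witt n) : anchor n (f ⊗ₜ[ℂ] D) = f • D := rfl

lemma anchor_extend (D : Jet n) : anchor n (extend (taylorInv n) (D : Witt n)) = 0 := by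
  have h0 : ∀ f : Poly n, LinearMap.mul' ℂ (Poly n) (taylorInv n f) = C (constantCoeff f) := by
    intro f
    have : (Algebra.TensorProduct.lmul' ℂ (S := Poly n)).comp (taylorInv n)
        = (Algebra.ofId ℂ (Poly n)).comp (aeval (fun _ => 0)) := by
      apply MvPolynomial.algHom_ext
      intro i
      simp [taylorInv]
    have h := DFunLike.congr_fun this f
    have h2 : LinearMap.mul' ℂ (Poly n) (taylorInv n f)
      = (Algebra.ofId ℂ (Poly n)) (aeval (fun _ => (0 : ℂ)) f) := h
    rw [h2]
    simp [Algebra.ofId_apply, MvPolynomial.algebraMap_eq]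
  have h1 : ∀ (k : Fin n) (P : Poly n ⊗[ℂ] Poly n),
      anchor n ((field k).lTensor (Poly n) P) = field k (LinearMap.mul' ℂ (Poly n) P) := by
    intro k P
    induction P with
    | zero => simp
    | add x y hx hy => simp only [map_add, hx, hy]
    | tmul p q => simp [mul_smul]
  rw [extend_apply, map_sum]
  refine Finset.sum_eq_zero fun k _ => ?_
  have h2 : constantCoeff ((D : Witt n) (X k)) = 0 := D.2 k
  rw [h1, h0, h2, map_zero, map_zero]

lemma smash_smul (z : Poly n ⊗[ℂ] Witt n) (f : Poly n) (v : M) :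
    smash M z (f • v) = anchor n z f • v + f • smash M z v := by
  induction z with
  | zero => simp
  | add x y hx hy =>
    simp only [map_add, LinearMap.add_apply, hx, hy, Derivation.add_apply, add_smul, smul_add]
    abel
  | tmul p D =>
    simp only [smash_tmul, IsAWModule.lie_smul_poly, anchor_tmul, Derivation.smul_apply, smul_add,
      smul_smul, smul_eq_mul, mul_comm f p]

lemma smash_comm (y z : Poly n ⊗[ℂ] Witt n) (v : M) :
    smash M y (smash M z v) - smash M z (smash M y v) =
      smash M (⁅y, z⁆ + (anchor n y).toLinearMap.rTensor _ z
        - (anchor n z).toLinearMap.rTensor _ y) v := by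
  have hA : ∀ (D E : Witt n) (w : Poly n ⊗[ℂ] Witt n), (D + E).toLinearMap.rTensor (Witt n) w
      = D.toLinearMap.rTensor _ w + E.toLinearMap.rTensor _ w := by
    intro D E w
    rw [← LinearMap.add_apply, ← LinearMap.rTensor_add]
    rfl
  have h0 : ∀ w : Poly n ⊗[ℂ] Witt n, (0 : Witt n).toLinearMap.rTensor (Witt n) w = 0 := by
    intro w
    have : (0 : Witt n).toLinearMap = 0 := rfl
    rw [this]; simp
  induction y with
  | zero => simp [ext_zero_lie, h0]
  | add x y hx hy =>
    have e : ⁅x + y, z⁆ + (anchor n (x + y)).toLinearMap.rTensor _ z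
        - (anchor n z).toLinearMap.rTensor _ (x + y)
        = (⁅x, z⁆ + (anchor n x).toLinearMap.rTensor _ z - (anchor n z).toLinearMap.rTensor _ x)
        + (⁅y, z⁆ + (anchor n y).toLinearMap.rTensor _ z
          - (anchor n z).toLinearMap.rTensor _ y) := by
      simp only [ext_add_lie, map_add, hA]; abel
    rw [e]
    refine Eq.trans ?_ (LinearMap.congr_fun (map_add (smash M) _ _) v).symm
    rw [LinearMap.add_apply, ← hx, ← hy]
    simp only [map_add, LinearMap.add_apply]
    abel
  | tmul p D =>
    induction z with
    | zero => simp [ext_lie_zero, h0]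
    | add x y hx hy =>
      generalize p ⊗ₜ[ℂ] D = z at *
      have e : ⁅z, x + y⁆ + (anchor n z).toLinearMap.rTensor _ (x + y)
          - (anchor n (x + y)).toLinearMap.rTensor _ z
          = (⁅z, x⁆ + (anchor n z).toLinearMap.rTensor _ x
            - (anchor n x).toLinearMap.rTensor _ z)
          + (⁅z, y⁆ + (anchor n z).toLinearMap.rTensor _ y
            - (anchor n y).toLinearMap.rTensor _ z) := by
        simp only [ext_lie_add, map_add, hA]; abel
      rw [e]
      refine Eq.trans ?_ (LinearMap.congr_fun (map_add (smash M) _ _) v).symm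
      rw [LinearMap.add_apply, ← hx, ← hy]
      simp only [map_add, LinearMap.add_apply]
      abel
    | tmul q E =>
      simp only [map_add, map_sub, LinearMap.add_apply, LinearMap.sub_apply, smash_tmul, ext_tmul,
        LinearMap.rTensor_tmul, anchor_tmul, Derivation.coeFn_coe, Derivation.smul_apply,
        IsAWModule.lie_smul_poly, lie_lie, smul_add, smul_sub, smul_smul, smul_eq_mul,
        mul_comm q p]
      abel

lemma jetOp_smul (D : Jet n) (f : Poly n) (v : M) :
    jetOp M (D : Witt n) (f • v) = f • jetOp M (D : Witt n) v := by
  rw [jetOp, smash_smul, anchor_extend]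
  simp

lemma jetOp_lie (D E : Jet n) (v : M) :
    jetOp M ⁅(D : Witt n), (E : Witt n)⁆ v =
      jetOp M (D : Witt n) (jetOp M (E : Witt n) v)
        - jetOp M (E : Witt n) (jetOp M (D : Witt n) v) := by
  have h0 : ∀ w : Poly n ⊗[ℂ] Witt n, (0 : Witt n).toLinearMap.rTensor (Witt n) w = 0 := by
    intro w
    have : (0 : Witt n).toLinearMap = 0 := rfl
    rw [this]; simp
  rw [jetOp, jetOp, jetOp, smash_comm, anchor_extend, anchor_extend, h0, h0, add_zero, sub_zero,
    extend_lie _ lTensor_taylorInv]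

lemma jetOp_pderiv (D : Jet n) (i : Fin n) (v : M) :
    ⁅(pderiv i : Witt n), jetOp M (D : Witt n) v⁆
      = jetOp M (D : Witt n) ⁅(pderiv i : Witt n), v⁆ := by
  have h0 : ∀ w : Poly n ⊗[ℂ] Witt n, (0 : Witt n).toLinearMap.rTensor (Witt n) w = 0 := by
    intro w
    have : (0 : Witt n).toLinearMap = 0 := rfl
    rw [this]; simp
  have h1 : ∀ w : M, ⁅(pderiv i : Witt n), w⁆ = smash M (1 ⊗ₜ[ℂ] (pderiv i : Witt n)) w := by
    intro w; simp
  have hc : ∀ (k : Fin n) (P : Poly n ⊗[ℂ] Poly n), (pderiv i : Witt n).toLinearMap.rTensor (Witt n)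
      ((field k).lTensor (Poly n) P) = (field k).lTensor (Poly n)
        ((pderiv i : Witt n).toLinearMap.rTensor (Poly n) P) := by
    intro k P
    rw [← LinearMap.comp_apply, ← LinearMap.comp_apply, LinearMap.rTensor_comp_lTensor,
      LinearMap.lTensor_comp_rTensor]
  have key : ∀ (k : Fin n) (P : Poly n ⊗[ℂ] Poly n),
      ⁅(1 : Poly n) ⊗ₜ[ℂ] (pderiv i : Witt n), (field k).lTensor (Poly n) P⁆ =
        (field k).lTensor (Poly n) ((pderiv i : Witt n).toLinearMap.lTensor (Poly n) P) := by
    intro k P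
    have := lie_lTensor_field i k (1 ⊗ₜ[ℂ] 1) P
    rw [← Algebra.TensorProduct.one_def, one_mul, Algebra.TensorProduct.one_def] at this
    simpa using this
  rw [h1, h1, ← sub_eq_zero, jetOp, smash_comm, anchor_extend, h0, sub_zero, anchor_tmul, one_smul,
    extend_apply, ext_lie_sum, map_sum]
  simp only [key, hc, lTensor_taylorInv, rTensor_taylorInv, map_neg, Finset.sum_neg_distrib,
    add_neg_cancel, map_zero, LinearMap.zero_apply]

variable (a : Fin n → ℂ)

/-- `L_n` acts on `Wh_a(M)` through the operators `jetOp`. -/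
instance : LieRingModule (Jet n) (Wh a M) where
  bracket D v := ⟨jetOp M (D : Witt n) v, fun i => by
    rw [jetOp_pderiv, v.2 i, map_smul]⟩
  add_lie D E v := by
    apply Subtype.ext
    change jetOp M ((D : Witt n) + (E : Witt n)) (v : M)
      = jetOp M (D : Witt n) (v : M) + jetOp M (E : Witt n) (v : M)
    simp only [jetOp, map_add, LinearMap.add_apply]
  lie_add D v w := Subtype.ext (map_add (jetOp M (D : Witt n)) (v : M) (w : M))
  leibniz_lie D E v := Subtype.ext (sub_eq_iff_eq_add.1 (jetOp_lie M D E (v : M)).symm)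

lemma coe_lie_Wh (D : Jet n) (v : Wh a M) : ((⁅D, v⁆ : Wh a M) : M) = jetOp M (D : Witt n) v := rfl

instance : LieModule ℂ (Jet n) (Wh a M) where
  smul_lie c D v := by
    apply Subtype.ext
    change jetOp M (c • (D : Witt n)) (v : M) = c • jetOp M (D : Witt n) (v : M)
    simp only [jetOp, map_smul, LinearMap.smul_apply]
  lie_smul c D v := Subtype.ext (map_smul (jetOp M (D : Witt n)) c (v : M))

variable {M} {N : Type*} [AddCommGroup N] [Module ℂ N] [Module (Poly n) N]
  [LieRingModule (Witt n) N] [IsAWModule n N]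

lemma map_smash (f : M →ₗ[Poly n] N) (hf : ∀ (D : Witt n) (v : M), f ⁅D, v⁆ = ⁅D, f v⁆)
    (z : Poly n ⊗[ℂ] Witt n) (v : M) : f (smash M z v) = smash N z (f v) := by
  induction z with
  | zero => simp
  | add x y hx hy => simp only [map_add, LinearMap.add_apply, hx, hy]
  | tmul p D => simp only [smash_tmul, map_smul, hf]

/-- The restriction of a homomorphism of `(A_n, W_n)`-modules to the Whittaker vectors. -/
def Wh.map (f : M →ₗ[Poly n] N) (hf : ∀ (D : Witt n) (v : M), f ⁅D, v⁆ = ⁅D, f v⁆) :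
    Wh a M →ₗ⁅ℂ, Jet n⁆ Wh a N where
  toFun v := ⟨f v, fun i => by
    rw [← hf, v.2 i, LinearMap.map_smul_of_tower]⟩
  map_add' v w := Subtype.ext (map_add f (v : M) (w : M))
  map_smul' c v := Subtype.ext (LinearMap.map_smul_of_tower f c (v : M))
  map_lie' := Subtype.ext (map_smash f hf _ _)

end WhAction

/-! ### The two categories and the two functors -/

/-- A finite-dimensional `L_n`-module. -/
structure JetMod (n : ℕ) where
  /-- The underlying vector space. -/
  carrier : Type u
  [addCommGroup : AddCommGroup carrier]
  [module : Module ℂ carrier]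
  [lieRingModule : LieRingModule (Jet n) carrier]
  [lieModule : LieModule ℂ (Jet n) carrier]
  [finiteDimensional : FiniteDimensional ℂ carrier]

attribute [instance] JetMod.addCommGroup JetMod.module JetMod.lieRingModule JetMod.lieModule
  JetMod.finiteDimensional

/-- The category `L_n-mod` of finite-dimensional `L_n`-modules. -/
instance (n : ℕ) : Category (JetMod.{u} n) where
  Hom V V' := V.carrier →ₗ⁅ℂ, Jet n⁆ V'.carrier
  id _ := LieModuleHom.id
  comp f g := LieModuleHom.comp g f

/-- A Whittaker `(A_n, W_n)`-module of type `φ_a` with finite-dimensional space of Whittaker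
vectors. -/
structure WhittakerMod (n : ℕ) (a : Fin n → ℂ) where
  /-- The underlying vector space. -/
  carrier : Type u
  [addCommGroup : AddCommGroup carrier]
  [module : Module ℂ carrier]
  [modulePoly : Module (Poly n) carrier]
  [lieRingModule : LieRingModule (Witt n) carrier]
  [isAWModule : IsAWModule n carrier]
  isWhittaker : IsWhittaker a carrier
  [finiteDimensional : FiniteDimensional ℂ (Wh a carrier)]

attribute [instance] WhittakerMod.addCommGroup WhittakerMod.module WhittakerMod.modulePoly
  WhittakerMod.lieRingModule WhittakerMod.isAWModule WhittakerMod.finiteDimensional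

/-- Homomorphisms of `(A_n, W_n)`-modules. -/
@[ext]
structure WhittakerMod.Hom {n : ℕ} {a : Fin n → ℂ} (M N : WhittakerMod.{u} n a) where
  /-- The underlying `A_n`-linear map. -/
  toLinearMap : M.carrier →ₗ[Poly n] N.carrier
  map_lie : ∀ (D : Witt n) (v : M.carrier), toLinearMap ⁅D, v⁆ = ⁅D, toLinearMap v⁆

/-- The category `Ω_a` of Whittaker `(A_n, W_n)`-modules of type `φ_a` with finite-dimensional
space of Whittaker vectors. -/
instance (n : ℕ) (a : Fin n → ℂ) : Category (WhittakerMod.{u} n a) where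
  Hom := WhittakerMod.Hom
  id _ := ⟨LinearMap.id, fun _ _ => rfl⟩
  comp f g := ⟨g.toLinearMap ∘ₗ f.toLinearMap, fun D v => by
    rw [LinearMap.comp_apply, f.map_lie, g.map_lie]; rfl⟩

lemma T.map_act {n : ℕ} (a : Fin n → ℂ) {V V' : Type u} [AddCommGroup V] [Module ℂ V]
    [LieRingModule (Jet n) V] [LieModule ℂ (Jet n) V] [AddCommGroup V'] [Module ℂ V']
    [LieRingModule (Jet n) V'] [LieModule ℂ (Jet n) V'] (g : V →ₗ⁅ℂ, Jet n⁆ V') (D : Witt n)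
    (w : Poly n ⊗[ℂ] V) :
    (g : V →ₗ[ℂ] V').baseChange (Poly n) (act a V D w)
      = act a V' D ((g : V →ₗ[ℂ] V').baseChange (Poly n) w) := by
  induction w with
  | zero =>
    have h : ∀ (U : Type u) [AddCommGroup U] [Module ℂ U] [LieRingModule (Jet n) U]
        [LieModule ℂ (Jet n) U], act a U D 0 = 0 := by
      intros
      simp [act, ext_lie_zero]
    rw [h, map_zero, h]
  | add x y hx hy => rw [act_add, map_add, hx, hy, map_add, act_add]
  | tmul p v =>
    have h : ∀ z : Poly n ⊗[ℂ] Jet n, (g : V →ₗ[ℂ] V').baseChange (Poly n) ⁅z, p ⊗ₜ[ℂ] v⁆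
        = ⁅z, p ⊗ₜ[ℂ] g v⁆ := by
      intro z
      induction z with
      | zero => simp [ext_zero_lie]
      | add x y hx hy => rw [ext_add_lie, map_add, hx, hy, ext_add_lie]
      | tmul q x =>
        rw [ext_tmul, ext_tmul, LinearMap.baseChange_tmul, ← LieModuleHom.map_lie]
        rfl
    simp only [act, map_add, h, LinearMap.rTensor_tmul, LinearMap.baseChange_tmul,
      LieModuleHom.coe_toLinearMap]

/-- The functor `V ↦ T(A_n^a, V)`, `g ↦ id ⊗ g`. -/
def tensorFunctor (n : ℕ) (a : Fin n → ℂ) : JetMod.{u} n ⥤ WhittakerMod.{u} n a where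
  obj V := { carrier := T a V.carrier, isWhittaker := T.isWhittaker a V.carrier }
  map {V V'} g := ⟨LinearMap.baseChange (Poly n)
    ((show V.carrier →ₗ⁅ℂ, Jet n⁆ V'.carrier from g) : V.carrier →ₗ[ℂ] V'.carrier), T.map_act a g⟩
  map_id _ := WhittakerMod.Hom.ext LinearMap.baseChange_id
  map_comp _ _ := WhittakerMod.Hom.ext (LinearMap.baseChange_comp _ _)

/-- The functor `M ↦ Wh_a(M)`, sending a homomorphism to its restriction. -/
def whFunctor (n : ℕ) (a : Fin n → ℂ) : WhittakerMod.{u} n a ⥤ JetMod.{u} n where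
  obj M := { carrier := Wh a M.carrier }
  map f := Wh.map a f.toLinearMap f.map_lie
  map_id _ := rfl
  map_comp _ _ := rfl

end WhittakerWitt

end

namespace WhittakerWitt

noncomputable section

/-! ### The Taylor expansions are mutually inverse -/

section Taylor

variable {n : ℕ}

/-! On any `(A_n, W_n)`-module the action splits into two commuting parts: a Weyl algebra, generated
by the `t_i` and the `∂_i`, and the operators `jetOp`, which make up an action of `L_n`.
`jetOp_smul` and `jetOp_pderiv` give the commutation. The splitting loses nothing, because `taylor`
and `taylorInv` are the substitutions `s ↦ t + s` and `s ↦ s - t`, inverse to each other over `A_n`.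
Extended to vector fields this gives two identities. `liftBaseChange_jetPart` says that the element
of `A_n ⊗ W_n` defining `jetOp D` has jet part `1 ⊗ D`. `liftBaseChange_extend` leads to
`lie_eq_constPart_add_jetPart`, which recovers every vector field from the `∂_k` and the `jetOp`.

On the Weyl algebra side the argument is of Kashiwara type. The operators `∂_i - a_i` commute and
are locally nilpotent on a Whittaker module, so in characteristic zero such a module is free over
`A_n` on their joint kernel `Wh_a(M)`. Generation is `IsWhittaker.span_Wh`; independence comes from
`IsWhittaker.injective_of_Wh`, which tests injectivity on Whittaker vectors only.

The two natural isomorphisms are then explicit. The unit `v ↦ 1 ⊗ v` is bijective onto the Whittaker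
vectors by `T.one_injective` and `T.Wh_le`, and `L_n`-linear by `T.jetOp_one`. The counit `p ⊗ v ↦ p
v` is `W_n`-linear by `T.counit_lie` and bijective by `T.counit_bijective`. -/

lemma productMap_taylor_taylorInv (f : Poly n) :
    Algebra.TensorProduct.productMap Algebra.TensorProduct.includeLeft (taylor n) (taylorInv n f)
      = 1 ⊗ₜ[ℂ] f := by
  have : (Algebra.TensorProduct.productMap Algebra.TensorProduct.includeLeft (taylor n)).comp
      (taylorInv n) = Algebra.TensorProduct.includeRight := by
    apply MvPolynomial.algHom_ext
    intro i
    simp [taylor, taylorInv, ← Algebra.TensorProduct.one_def]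
  exact DFunLike.congr_fun this f

/-- Here and in the companion identity, `productMap includeLeft δ` is the extension of `δ` that is
linear over the first tensor factor. Both sides are algebra maps, so it suffices to look at the
variables, where the shifts by `t` and `-t` cancel. -/
lemma productMap_taylorInv_taylor (f : Poly n) :
    Algebra.TensorProduct.productMap Algebra.TensorProduct.includeLeft (taylorInv n) (taylor n f)
      = 1 ⊗ₜ[ℂ] f := by
  have : (Algebra.TensorProduct.productMap Algebra.TensorProduct.includeLeft (taylorInv n)).comp
      (taylor n) = Algebra.TensorProduct.includeRight := by
    apply MvPolynomial.algHom_ext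
    intro i
    simp [taylor, taylorInv, ← Algebra.TensorProduct.one_def]
  exact DFunLike.congr_fun this f

lemma jetPart_field (k : Fin n) (f : Poly n) :
    jetPart n (field k f) = (jetField k).lTensor (Poly n) (taylor n f) := by
  classical
  rw [jetPart_apply, Finset.sum_eq_single k]
  · simp
  · intro j _ hj
    simp [pderiv_X, hj]
  · simp

lemma extend_field (δ : Poly n →ₐ[ℂ] Poly n ⊗[ℂ] Poly n) (k : Fin n) (f : Poly n) :
    extend δ (field k f) = (field k).lTensor (Poly n) (δ f) := by
  classical
  rw [extend_apply, Finset.sum_eq_single k]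
  · simp
  · intro j _ hj
    simp [pderiv_X, hj]
  · simp

/-- The coefficients of a field in `L_n` vanish at the origin, so the constant that `jetField`
subtracts is zero. -/
lemma sum_jetField (D : Jet n) : ∑ k, jetField k ((D : Witt n) (X k)) = D := by
  apply Subtype.ext
  have h : ∀ k, ((jetField k ((D : Witt n) (X k)) : Jet n) : Witt n)
      = (D : Witt n) (X k) • (pderiv k : Witt n) := by
    intro k
    change field k _ = _
    have : constantCoeff ((D : Witt n) (X k)) = 0 := D.2 k
    rw [this, map_zero, sub_zero, field_apply]
  have hs : ((∑ k, jetField k ((D : Witt n) (X k)) : Jet n) : Witt n)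
      = ∑ k, ((jetField k ((D : Witt n) (X k)) : Jet n) : Witt n) :=
    map_sum (jetIncl n) _ _
  rw [hs, Finset.sum_congr rfl fun k _ => h k, ← witt_eq_sum]

/-- Transfers identities between substitutions of polynomials to maps of vector fields: if `Φ` acts
on coefficients through `δ`, then its `A_n`-linear extension acts through the `A_n`-linear extension
of `δ`. -/
lemma liftBaseChange_lTensor {U N : Type*} [AddCommGroup U] [Module ℂ U] [AddCommGroup N]
    [Module ℂ N] (δ : Poly n →ₐ[ℂ] Poly n ⊗[ℂ] Poly n) (φ : Poly n →ₗ[ℂ] U)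
    (ψ : Poly n →ₗ[ℂ] N) (Φ : U →ₗ[ℂ] Poly n ⊗[ℂ] N)
    (h : ∀ f, Φ (φ f) = ψ.lTensor (Poly n) (δ f)) (P : Poly n ⊗[ℂ] Poly n) :
    Φ.liftBaseChange (Poly n) (φ.lTensor (Poly n) P) = ψ.lTensor (Poly n)
      (Algebra.TensorProduct.productMap Algebra.TensorProduct.includeLeft δ P) := by
  have hs : ∀ (p : Poly n) (Q : Poly n ⊗[ℂ] Poly n),
      p • ψ.lTensor (Poly n) Q = ψ.lTensor (Poly n) (p ⊗ₜ[ℂ] 1 * Q) := by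
    intro p Q
    induction Q with
    | zero => simp
    | add x y hx hy => simp only [map_add, smul_add, mul_add, hx, hy]
    | tmul q r => simp [TensorProduct.smul_tmul']
  induction P with
  | zero => simp
  | add x y hx hy => simp only [map_add, hx, hy]
  | tmul p q =>
    rw [LinearMap.lTensor_tmul, LinearMap.liftBaseChange_tmul, h, hs,
      Algebra.TensorProduct.productMap_apply_tmul]
    rfl

/-- `taylor` undoes `taylorInv` coefficientwise. This is the reason the action on `Wh_a(T(A_n^a,
V))` gives back the original action on `V`. -/
lemma liftBaseChange_jetPart (D : Jet n) :
    (jetPart n).liftBaseChange (Poly n) (extend (taylorInv n) (D : Witt n)) = 1 ⊗ₜ[ℂ] D := by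
  have h := fun k => liftBaseChange_lTensor (taylor n) (field k) (jetField k) (jetPart n)
    (jetPart_field k)
  simp only [extend_apply, map_sum, h, productMap_taylor_taylorInv, LinearMap.lTensor_tmul]
  rw [← TensorProduct.tmul_sum, sum_jetField]

/-- The opposite cancellation, valid on all of `W_n`; it serves to rebuild a vector field from its
Taylor expansion. -/
lemma liftBaseChange_extend (D : Witt n) :
    (extend (taylorInv n)).liftBaseChange (Poly n) (extend (taylor n) D) = 1 ⊗ₜ[ℂ] D := by
  have h := fun k => liftBaseChange_lTensor (taylorInv n) (field k) (field k)
    (extend (taylorInv n)) (extend_field _ k)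
  simp only [extend_apply (taylor n), map_sum, h, productMap_taylorInv_taylor,
    LinearMap.lTensor_tmul]
  rw [← TensorProduct.tmul_sum]
  simp only [field_apply]
  rw [← witt_eq_sum]

lemma extend_pderiv (δ : Poly n →ₐ[ℂ] Poly n ⊗[ℂ] Poly n) (i : Fin n) :
    extend δ (pderiv i) = 1 ⊗ₜ[ℂ] (pderiv i : Witt n) := by
  have h := extend_field δ i 1
  simpa [Algebra.TensorProduct.one_def] using h

end Taylor

/-! ### The unit `V → Wh_a(T(A_n^a, V))` -/

section Unit

variable {n : ℕ} (a : Fin n → ℂ) (V : Type u) [AddCommGroup V] [Module ℂ V]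

/-- Evaluating the polynomial factor at the origin is a left inverse. -/
lemma T.one_injective : Function.Injective (T.one a V) := by
  have h : ∀ v, (TensorProduct.lid ℂ V) ((aeval (fun _ => (0 : ℂ)) :
      Poly n →ₐ[ℂ] ℂ).toLinearMap.rTensor V (T.one a V v)) = v := by
    intro v
    change (TensorProduct.lid ℂ V) (LinearMap.rTensor V _ ((1 : Poly n) ⊗ₜ[ℂ] v)) = v
    simp
  exact fun v w e => by rw [← h v, e, h w]

variable [LieRingModule (Jet n) V] [LieModule ℂ (Jet n) V]

/-- Derivations kill `1`, so the twisted part contributes only its `a_k` terms, and these depend on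
`z` through the anchor alone. What remains is the jet part, extended `A_n`-linearly. -/
lemma T.smash_one (z : Poly n ⊗[ℂ] Witt n) (v : V) :
    (smash (T a V) z (T.one a V v) : Poly n ⊗[ℂ] V) =
      (∑ k, a k • anchor n z (X k)) ⊗ₜ[ℂ] v
        + ⁅(jetPart n).liftBaseChange (Poly n) z, (1 : Poly n) ⊗ₜ[ℂ] v⁆ := by
  have hs : ∀ (p : Poly n) (y : Poly n ⊗[ℂ] Jet n) (w : Poly n ⊗[ℂ] V),
      p • ⁅y, w⁆ = ⁅p • y, w⁆ := by
    intro p y w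
    induction w with
    | zero => simp [ext_lie_zero]
    | add x y hx hy => simp only [ext_lie_add, smul_add, hx, hy]
    | tmul q v =>
      induction y with
      | zero => simp [ext_zero_lie]
      | add x y hx hy => simp only [ext_add_lie, smul_add, hx, hy]
      | tmul r x => simp only [ext_tmul, TensorProduct.smul_tmul', smul_eq_mul, mul_assoc]
  induction z with
  | zero => simp [ext_zero_lie]; rfl
  | add x y hx hy =>
    have e : (smash (T a V) (x + y) (T.one a V v) : Poly n ⊗[ℂ] V) =
        (smash (T a V) x (T.one a V v) : Poly n ⊗[ℂ] V) + smash (T a V) y (T.one a V v) := by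
      rw [map_add]; rfl
    rw [e, hx, hy]
    simp only [map_add, Derivation.add_apply, smul_add, Finset.sum_add_distrib,
      TensorProduct.add_tmul, ext_add_lie]
    abel
  | tmul p D =>
    change p • T.act a V D ((1 : Poly n) ⊗ₜ[ℂ] v) = _
    rw [T.act, smul_add, LinearMap.liftBaseChange_tmul, ← hs, LinearMap.rTensor_tmul,
      twist_apply, TensorProduct.smul_tmul', anchor_tmul]
    simp [Finset.mul_sum]

/-- The element defining `jetOp D` has zero anchor, which removes every `a_k`, and its jet part is
`1 ⊗ D`. -/
lemma T.jetOp_one (D : Jet n) (v : V) :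
    jetOp (T a V) (D : Witt n) (T.one a V v) = T.one a V ⁅D, v⁆ := by
  refine (T.smash_one a V _ v).trans ?_
  rw [liftBaseChange_jetPart, anchor_extend, ext_tmul, one_mul]
  simp
  rfl

lemma T.one_mem_Wh (v : V) : T.one a V v ∈ Wh a (T a V) := by
  intro i
  change T.act a V (pderiv i) ((1 : Poly n) ⊗ₜ[ℂ] v) = a i • ((1 : Poly n) ⊗ₜ[ℂ] v)
  rw [T.act_pderiv]
  simp

/-- The isomorphism `V ≅ Wh_a(T(A_n^a, V))`, `v ↦ 1 ⊗ v`, of `L_n`-modules. -/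
def T.unitEquiv : V ≃ₗ⁅ℂ, Jet n⁆ Wh a (T a V) where
  __ := LinearEquiv.ofBijective ((T.one a V).codRestrict (Wh a (T a V)) (T.one_mem_Wh a V))
    ⟨fun v w h => T.one_injective a V (congrArg Subtype.val h), fun w => by
      obtain ⟨v, hv⟩ := T.Wh_le a V w.2
      exact ⟨v, Subtype.ext hv⟩⟩
  map_lie' {D v} := Subtype.ext (T.jetOp_one a V D v).symm

end Unit

/-! ### Local nilpotency of `∂_i - a_i` -/

section Weyl

/-- In a module over the Weyl algebra of one variable, a vector on which the derivative is
nilpotent is a combination of the `t^l u` with `u` killed by the derivative. -/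
lemma mem_span_of_pow_eq_zero {M : Type*} [AddCommGroup M] [Module ℂ M] (d t : Module.End ℂ M)
    (h : ∀ v, d (t v) = t (d v) + v) (K : Submodule ℂ M) (hd : ∀ v ∈ K, d v ∈ K)
    (ht : ∀ v ∈ K, t v ∈ K) (k : ℕ) (w : M) (hw : w ∈ K) (hk : (d ^ k) w = 0) :
    w ∈ Submodule.span ℂ {x | ∃ (l : ℕ) (u : M), u ∈ K ∧ d u = 0 ∧ x = (t ^ l) u} := by
  set S := {x | ∃ (l : ℕ) (u : M), u ∈ K ∧ d u = 0 ∧ x = (t ^ l) u} with hS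
  -- Needed so that subtracting an antiderivative taken from the span does not leave `K`.
  have hSK : Submodule.span ℂ S ≤ K := by
    rw [Submodule.span_le]
    rintro _ ⟨l, u, hu, -, rfl⟩
    induction l with
    | zero => simpa using hu
    | succ l ih => rw [pow_succ', Module.End.mul_apply]; exact ht _ ih
  have hder : ∀ (l : ℕ) (u : M), d u = 0 → d ((t ^ (l + 1)) u) = ((l : ℂ) + 1) • (t ^ l) u := by
    intro l u hu
    induction l with
    | zero => simp [h, hu]
    | succ l ih =>
      rw [pow_succ' t (l + 1), Module.End.mul_apply, h, ih, map_smul, ← Module.End.mul_apply,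
        ← pow_succ']
      push_cast
      module
  -- The span is closed under integration: `t^(l+1) u / (l+1)` is an antiderivative of `t^l u`.
  -- Characteristic zero enters here.
  have hint : ∀ x ∈ Submodule.span ℂ S, ∃ y ∈ Submodule.span ℂ S, d y = x := by
    intro x hx
    induction hx using Submodule.span_induction with
    | mem x hx =>
      obtain ⟨l, u, hu, hdu, rfl⟩ := hx
      refine ⟨((l : ℂ) + 1)⁻¹ • (t ^ (l + 1)) u,
        Submodule.smul_mem _ _ (Submodule.subset_span ⟨l + 1, u, hu, hdu, rfl⟩), ?_⟩
      rw [map_smul, hder l u hdu, smul_smul, inv_mul_cancel₀ (Nat.cast_add_one_ne_zero l),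
        one_smul]
    | zero => exact ⟨0, Submodule.zero_mem _, map_zero d⟩
    | add x y _ _ hx hy =>
      obtain ⟨x', hx', rfl⟩ := hx
      obtain ⟨y', hy', rfl⟩ := hy
      exact ⟨x' + y', Submodule.add_mem _ hx' hy', map_add d _ _⟩
    | smul c x _ hx =>
      obtain ⟨x', hx', rfl⟩ := hx
      exact ⟨c • x', Submodule.smul_mem _ _ hx', map_smul d _ _⟩
  induction k generalizing w with
  | zero =>
    have : w = 0 := by simpa using hk
    rw [this]
    exact Submodule.zero_mem _
  | succ k ih =>
    rw [pow_succ, Module.End.mul_apply] at hk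
    -- By induction `d w` lies in the span. For an antiderivative `y` of it, `w - y` is killed by
    -- `d` and is a generator with `l = 0`.
    obtain ⟨y, hy, hyw⟩ := hint _ (ih (d w) (hd w hw) hk)
    rw [← sub_add_cancel w y]
    refine Submodule.add_mem _ (Submodule.subset_span ⟨0, w - y, ?_, ?_, by simp⟩) hy
    · exact Submodule.sub_mem _ hw (hSK hy)
    · rw [map_sub, hyw, sub_self]

variable {n : ℕ} (a : Fin n → ℂ) {M : Type*} [AddCommGroup M] [Module ℂ M] [Module (Poly n) M]
  [LieRingModule (Witt n) M] [IsAWModule n M]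

variable (M) in
/-- The operator `∂_i - a_i`. -/
def whOp (i : Fin n) : Module.End ℂ M :=
  LieModule.toEnd ℂ (Witt n) M (pderiv i : Witt n) - a i • (1 : Module.End ℂ M)

lemma whOp_apply (i : Fin n) (v : M) : whOp a M i v = ⁅(pderiv i : Witt n), v⁆ - a i • v := rfl

lemma mem_Wh_iff_whOp (v : M) : v ∈ Wh a M ↔ ∀ i, whOp a M i v = 0 := by
  simp only [whOp_apply, sub_eq_zero]
  rfl

lemma whOp_comm (i j : Fin n) (v : M) :
    whOp a M i (whOp a M j v) = whOp a M j (whOp a M i v) := by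
  have h : ⁅(pderiv i : Witt n), ⁅(pderiv j : Witt n), v⁆⁆
      = ⁅(pderiv j : Witt n), ⁅(pderiv i : Witt n), v⁆⁆ := by
    rw [leibniz_lie, pderiv_lie_pderiv, zero_lie, zero_add]
  simp only [whOp_apply, lie_sub, lie_smul, smul_sub, h, smul_comm (a i) (a j)]
  abel

lemma whOp_smul (i : Fin n) (f : Poly n) (v : M) :
    whOp a M i (f • v) = pderiv i f • v + f • whOp a M i v := by
  rw [whOp_apply, whOp_apply, IsAWModule.lie_smul_poly, smul_sub, smul_comm (a i) f v]
  abel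

variable {a}

/-- The Whittaker condition in the coordinate direction `i`. -/
lemma IsWhittaker.exists_whOp_pow_eq_zero (hM : IsWhittaker a M) (i : Fin n) (v : M) :
    ∃ k : ℕ, (whOp a M i ^ k) v = 0 := by
  classical
  obtain ⟨k, hk⟩ := hM v
  refine ⟨k, ?_⟩
  have := hk (Pi.single i 1)
  simpa [Pi.single_apply, whOp] using this

/-- A homomorphism out of a Whittaker module is injective if it is injective on the Whittaker
vectors. -/
lemma IsWhittaker.injective_of_Wh (hM : IsWhittaker a M) {N : Type*} [AddCommGroup N] [Module ℂ N]
    [Module (Poly n) N] [LieRingModule (Witt n) N] [IsAWModule n N] (f : M →ₗ[Poly n] N)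
    (hf : ∀ (D : Witt n) (v : M), f ⁅D, v⁆ = ⁅D, f v⁆)
    (h : ∀ v ∈ Wh a M, f v = 0 → v = 0) : Function.Injective f := by
  classical
  have hop : ∀ i v, f v = 0 → f (whOp a M i v) = 0 := by
    intro i v hv
    rw [whOp_apply, map_sub, hf, LinearMap.map_smul_of_tower, hv, lie_zero, smul_zero, sub_zero]
  -- `S` holds the directions in which `v` need not be killed: the empty set is the case of
  -- Whittaker vectors, the full set is the claim.
  have main : ∀ (S : Finset (Fin n)) (v : M), f v = 0 → (∀ i ∉ S, whOp a M i v = 0) → v = 0 := by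
    intro S
    induction S using Finset.induction_on with
    | empty =>
      intro v hv hS
      exact h v ((mem_Wh_iff_whOp a v).2 fun i => hS i (Finset.notMem_empty i)) hv
    | insert j S _ ih =>
      intro v hv hS
      obtain ⟨k, hk⟩ := hM.exists_whOp_pow_eq_zero j v
      induction k generalizing v with
      | zero => simpa using hk
      | succ k ihk =>
        rw [pow_succ, Module.End.mul_apply] at hk
        -- `whOp a M j v` satisfies the same hypotheses, since the operators commute and preserve
        -- the kernel of `f`, and its nilpotency order in direction `j` is one less.
        have h0 : whOp a M j v = 0 := ihk _ (hop j v hv)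
          (fun i hi => by rw [whOp_comm, hS i hi, map_zero]) hk
        refine ih v hv fun i hi => ?_
        by_cases hij : i = j
        · rw [hij, h0]
        · exact hS i (by simp [hij, hi])
  refine (injective_iff_map_eq_zero f).2 fun v hv => main Finset.univ v hv fun i hi => ?_
  exact absurd (Finset.mem_univ i) hi

/-- A Whittaker module is generated over `A_n` by its Whittaker vectors. -/
lemma IsWhittaker.span_Wh (hM : IsWhittaker a M) :
    Submodule.span (Poly n) (Wh a M : Set M) = ⊤ := by
  classical
  -- The same induction, freeing one direction at a time.
  have main : ∀ (S : Finset (Fin n)) (v : M), (∀ i ∉ S, whOp a M i v = 0) →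
      v ∈ Submodule.span (Poly n) (Wh a M : Set M) := by
    intro S
    induction S using Finset.induction_on with
    | empty =>
      intro v hS
      exact Submodule.subset_span
        ((mem_Wh_iff_whOp a v).2 fun i => hS i (Finset.notMem_empty i))
    | insert j S _ ih =>
      intro v hS
      obtain ⟨k, hk⟩ := hM.exists_whOp_pow_eq_zero j v
      -- The joint kernel in the remaining directions is stable under `whOp a M j` and under `X j`,
      -- whose other partial derivatives vanish. It is thus a module over the Weyl algebra in the
      -- single variable `t_j`.
      let K : Submodule ℂ M := ⨅ i ∈ (↑(insert j S) : Set (Fin n))ᶜ, LinearMap.ker (whOp a M i)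
      have hK : ∀ v, v ∈ K ↔ ∀ i ∉ insert j S, whOp a M i v = 0 := by
        intro v
        simp [K]
      let t : Module.End ℂ M := Algebra.lsmul ℂ ℂ M (X j : Poly n)
      have ht : ∀ v, t v = (X j : Poly n) • v := fun _ => rfl
      have hspan := mem_span_of_pow_eq_zero (whOp a M j) t
        (fun v => by rw [ht, ht, whOp_smul, pderiv_X_self, one_smul, add_comm]) K
        (fun v hv => (hK _).2 fun i hi => by rw [whOp_comm, (hK v).1 hv i hi, map_zero])
        (fun v hv => (hK _).2 fun i hi => by
          have hij : j ≠ i := fun h => hi (by simp [h])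
          rw [ht, whOp_smul, (hK v).1 hv i hi, pderiv_X_of_ne hij, zero_smul, smul_zero,
            add_zero]) k v ((hK v).2 hS) hk
      -- Each such `u` is also killed in direction `j`, so the induction hypothesis for `S` applies
      -- to it; powers of `X j` stay within the `A_n`-span.
      have hle : Submodule.span ℂ {x | ∃ (l : ℕ) (u : M), u ∈ K ∧ whOp a M j u = 0 ∧
          x = (t ^ l) u} ≤ (Submodule.span (Poly n) (Wh a M : Set M)).restrictScalars ℂ := by
        rw [Submodule.span_le]
        rintro _ ⟨l, u, hu, hju, rfl⟩
        induction l with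
        | zero =>
          refine ih u fun i hi => ?_
          by_cases hij : i = j
          · rw [hij, hju]
          · exact (hK u).1 hu i (by simp [hij, hi])
        | succ l ihl =>
          rw [pow_succ', Module.End.mul_apply, ht]
          exact Submodule.smul_mem (Submodule.span (Poly n) (Wh a M : Set M)) _ ihl
      exact hle hspan
  exact eq_top_iff.2 fun v _ => main Finset.univ v fun i hi => absurd (Finset.mem_univ i) hi

end Weyl

/-! ### The counit `T(A_n^a, Wh_a(M)) → M` -/

section Counit

variable {n : ℕ} (a : Fin n → ℂ) (M : Type u) [AddCommGroup M] [Module ℂ M] [Module (Poly n) M]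
  [LieRingModule (Witt n) M] [IsAWModule n M]

/-- The map `p ⊗ v ↦ p v`. -/
def T.counit : T a (Wh a M) →ₗ[Poly n] M :=
  (Wh a M).subtype.liftBaseChange (Poly n)

lemma T.counit_tmul (p : Poly n) (v : Wh a M) :
    T.counit a M (p ⊗ₜ[ℂ] v : Poly n ⊗[ℂ] Wh a M) = p • (v : M) :=
  LinearMap.liftBaseChange_tmul (A := Poly n) (Wh a M).subtype p v

variable {M} in
lemma smash_smul_left (p : Poly n) (z : Poly n ⊗[ℂ] Witt n) (v : M) :
    smash M (p • z) v = p • smash M z v := by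
  induction z with
  | zero => simp
  | add x y hx hy => simp only [smul_add, map_add, LinearMap.add_apply, hx, hy]
  | tmul q D => rw [TensorProduct.smul_tmul', smash_tmul, smash_tmul, smul_eq_mul, mul_smul]

variable {M} in
/-- The action of a vector field, expressed through the `∂_k` and the operators `jetOp`. -/
lemma lie_eq_constPart_add_jetPart (D : Witt n) (v : M) :
    ⁅D, v⁆ = smash M (constPart n D) v
      + smash M ((extend (taylorInv n)).liftBaseChange (Poly n)
          ((jetIncl n).lTensor (Poly n) (jetPart n D))) v := by
  -- The `∂_k` have constant coefficients and are unchanged by the substitution. Hence the extension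
  -- of `taylorInv` takes the jet part, which is the Taylor expansion minus `constPart`, to `1 ⊗ D`
  -- minus `constPart`.
  have h : (extend (taylorInv n)).liftBaseChange (Poly n) (constPart n D) = constPart n D := by
    simp only [constPart_apply, map_sum, LinearMap.liftBaseChange_tmul, extend_pderiv,
      TensorProduct.smul_tmul', smul_eq_mul, mul_one]
  rw [incl_jetPart, map_sub, liftBaseChange_extend, h, map_sub, LinearMap.sub_apply, smash_tmul,
    one_smul, add_sub_cancel]

/-- `L_n` acts on Whittaker vectors through `jetOp`, so the counit turns the jet term of `T.act`
into the second term of `lie_eq_constPart_add_jetPart`. -/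
lemma T.counit_lie_tmul (z : Poly n ⊗[ℂ] Jet n) (p : Poly n) (v : Wh a M) :
    T.counit a M (⁅z, p ⊗ₜ[ℂ] v⁆ : Poly n ⊗[ℂ] Wh a M) =
      p • smash M ((extend (taylorInv n)).liftBaseChange (Poly n)
          ((jetIncl n).lTensor (Poly n) z)) v := by
  induction z with
  | zero =>
    rw [ext_zero_lie]
    refine (map_zero (T.counit a M)).trans ?_
    simp
  | add x y hx hy =>
    rw [ext_add_lie]
    refine (map_add (T.counit a M) _ _).trans ?_
    rw [hx, hy]
    simp only [map_add, LinearMap.add_apply, smul_add]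
  | tmul q x =>
    rw [ext_tmul, T.counit_tmul, LinearMap.lTensor_tmul, LinearMap.liftBaseChange_tmul,
      smash_smul_left, coe_lie_Wh, jetOp, smul_smul, mul_comm]
    rfl

lemma T.counit_lie (D : Witt n) (w : T a (Wh a M)) :
    T.counit a M ⁅D, w⁆ = ⁅D, T.counit a M w⁆ := by
  change Poly n ⊗[ℂ] Wh a M at w
  change T.counit a M (T.act a (Wh a M) D w) = _
  induction w with
  | zero =>
    have h : T.act a (Wh a M) D 0 = 0 := by simp [T.act, ext_lie_zero]
    rw [h]
    exact (map_zero (T.counit a M)).trans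
      ((congrArg (fun x => ⁅D, x⁆) (map_zero (T.counit a M))).trans (lie_zero D)).symm
  | add x y hx hy =>
    rw [T.act_add]
    refine (map_add (T.counit a M) _ _).trans ?_
    rw [hx, hy, ← lie_add]
    exact congrArg (fun x => ⁅D, x⁆) (map_add (T.counit a M) x y).symm
  | tmul p v =>
    -- On a Whittaker vector each `∂_k` is the scalar `a_k`, so `constPart` acts as the
    -- multiplication term of `twist`. The Leibniz rule for `D (p v)` supplies the other term, `D
    -- p`.
    have hc : smash M (constPart n D) (v : M) = (∑ k, a k • D (X k)) • (v : M) := by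
      rw [constPart_apply, map_sum, LinearMap.sum_apply, Finset.sum_smul]
      refine Finset.sum_congr rfl fun k _ => ?_
      rw [smash_tmul, v.2 k, smul_comm, smul_assoc]
    rw [T.act]
    refine (map_add (T.counit a M) _ _).trans ?_
    rw [T.counit_lie_tmul, LinearMap.rTensor_tmul, T.counit_tmul, T.counit_tmul,
      IsAWModule.lie_smul_poly, lie_eq_constPart_add_jetPart D (v : M), hc, twist_apply,
      add_smul, smul_add, smul_smul, mul_comm p, add_assoc]

variable {M}

lemma T.counit_map {N : Type u} [AddCommGroup N] [Module ℂ N] [Module (Poly n) N]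
    [LieRingModule (Witt n) N] [IsAWModule n N] (f : M →ₗ[Poly n] N)
    (hf : ∀ (D : Witt n) (v : M), f ⁅D, v⁆ = ⁅D, f v⁆) (w : Poly n ⊗[ℂ] Wh a M) :
    T.counit a N ((Wh.map a f hf : Wh a M →ₗ[ℂ] Wh a N).baseChange (Poly n) w)
      = f (T.counit a M w) := by
  induction w with
  | zero =>
    rw [map_zero]
    exact (map_zero (T.counit a N)).trans
      ((congrArg f (map_zero (T.counit a M))).trans (map_zero f)).symm
  | add x y hx hy =>
    rw [map_add]
    refine (map_add (T.counit a N) _ _).trans ?_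
    rw [hx, hy, ← map_add]
    exact congrArg f (map_add (T.counit a M) x y).symm
  | tmul p v =>
    rw [LinearMap.baseChange_tmul, T.counit_tmul, T.counit_tmul, map_smul]
    rfl

/-- For injectivity, the source is itself a Whittaker module whose Whittaker vectors are the `1 ⊗
v`, and these go to `v`. For surjectivity, the image is an `A_n`-submodule containing the generating
set `Wh_a(M)`. -/
lemma T.counit_bijective (hM : IsWhittaker a M) : Function.Bijective (T.counit a M) := by
  constructor
  · refine (T.isWhittaker a (Wh a M)).injective_of_Wh (T.counit a M) (T.counit_lie a M) ?_
    intro w hw h0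
    obtain ⟨v, rfl⟩ := T.Wh_le a (Wh a M) hw
    have h1 : T.counit a M (T.one a (Wh a M) v) = v :=
      (T.counit_tmul a M 1 v).trans (one_smul _ _)
    have h2 : v = 0 := Subtype.ext (h1.symm.trans h0)
    rw [h2, map_zero]
  · rw [← LinearMap.range_eq_top, eq_top_iff, ← hM.span_Wh, Submodule.span_le]
    intro v hv
    exact ⟨T.one a (Wh a M) ⟨v, hv⟩, (T.counit_tmul a M 1 ⟨v, hv⟩).trans (one_smul _ _)⟩

end Counit

/-! ### The equivalence of categories -/

section Equivalence

variable {n : ℕ} {a : Fin n → ℂ}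

/-- An isomorphism of `L_n`-modules is an isomorphism in `L_n-mod`. -/
def JetMod.isoOfEquiv {V V' : JetMod.{u} n} (e : V.carrier ≃ₗ⁅ℂ, Jet n⁆ V'.carrier) : V ≅ V' where
  hom := (e : V.carrier →ₗ⁅ℂ, Jet n⁆ V'.carrier)
  inv := (e.symm : V'.carrier →ₗ⁅ℂ, Jet n⁆ V.carrier)
  hom_inv_id := LieModuleHom.ext fun v => e.symm_apply_apply v
  inv_hom_id := LieModuleHom.ext fun v => e.apply_symm_apply v

/-- A bijective homomorphism of `(A_n, W_n)`-modules is an isomorphism in `Ω_a`. -/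
def WhittakerMod.isoOfBijective {M N : WhittakerMod.{u} n a} (f : M.Hom N)
    (hf : Function.Bijective f.toLinearMap) : M ≅ N where
  hom := f
  inv := ⟨(LinearEquiv.ofBijective f.toLinearMap hf).symm, fun D v => by
    apply hf.1
    have h : ∀ w, f.toLinearMap ((LinearEquiv.ofBijective f.toLinearMap hf).symm w) = w :=
      (LinearEquiv.ofBijective f.toLinearMap hf).apply_symm_apply
    erw [f.map_lie, h, h]⟩
  hom_inv_id := WhittakerMod.Hom.ext (LinearMap.ext
    (LinearEquiv.ofBijective f.toLinearMap hf).symm_apply_apply)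
  inv_hom_id := WhittakerMod.Hom.ext (LinearMap.ext
    (LinearEquiv.ofBijective f.toLinearMap hf).apply_symm_apply)

variable (n a)

/-- The natural isomorphism `V ≅ Wh_a(T(A_n^a, V))`. -/
def unitNatIso : 𝟭 (JetMod.{u} n) ≅ tensorFunctor n a ⋙ whFunctor n a :=
  NatIso.ofComponents (fun V => JetMod.isoOfEquiv (V' := (tensorFunctor n a ⋙ whFunctor n a).obj V)
    (T.unitEquiv a V.carrier)) fun {V V'} g =>
    -- Naturality is `(id ⊗ g)(1 ⊗ v) = 1 ⊗ g v`.
    LieModuleHom.ext fun v => Subtype.ext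
      (LinearMap.baseChange_tmul (A := Poly n) (1 : Poly n)
        (f := ((show V.carrier →ₗ⁅ℂ, Jet n⁆ V'.carrier from g) : V.carrier →ₗ[ℂ] V'.carrier))
        (x := v)).symm

/-- The natural isomorphism `T(A_n^a, Wh_a(M)) ≅ M`. -/
def counitNatIso : whFunctor n a ⋙ tensorFunctor n a ≅ 𝟭 (WhittakerMod.{u} n a) :=
  NatIso.ofComponents (fun M => WhittakerMod.isoOfBijective
    (M := (whFunctor n a ⋙ tensorFunctor n a).obj M) (N := M)
    ⟨T.counit a M.carrier, T.counit_lie a M.carrier⟩ (T.counit_bijective a M.isWhittaker))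
    fun f => WhittakerMod.Hom.ext (LinearMap.ext fun w =>
      T.counit_map a f.toLinearMap f.map_lie w)

end Equivalence

end

end WhittakerWitt

theorem theorem3p4 (n : ℕ) (hn : 0 < n) (a : Fin n → ℂ) :
    ∃ e : WhittakerWitt.JetMod.{u} n ≌ WhittakerWitt.WhittakerMod.{u} n a,
      e.functor = WhittakerWitt.tensorFunctor n a ∧
        e.inverse = WhittakerWitt.whFunctor n a :=
  -- `Equivalence.mk` adjusts only the unit to obtain the triangle identity; both functors are kept
  -- as given, so the two equalities hold by `rfl`.
  ⟨CategoryTheory.Equivalence.mk _ _ (WhittakerWitt.unitNatIso n a)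
    (WhittakerWitt.counitNatIso n a), rfl, rfl⟩
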